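/- Let $n,d\ge 0$ be integers and $N=n+d$. A formal generic submanifold $M$ of codimension $d$ (CR dimension $n$) through $0\in\mathbb C^N$ is given by $\rho\in\mathbb C[[Z,\zeta]]^d$ with $\rho(Z,\zeta)=\bar\rho(\zeta,Z)$, $\rho(0)=0$ and $\partial_Z\rho_1(0)\wedge\dots\wedge\partial_Z\rho_d(0)\ne0$, where a bar over a series denotes complex conjugation of its coefficients. Normal coordinates for $M$ are a formal invertible change of coordinates $Z=Z(z,w)$, $(z,w)\in\mathbb C^n\times\mathbb C^d$, fixing $0$, such that $\rho(Z(z,w),\bar Z(\chi,\tau))=a(z,w,\chi,\tau)\,(w-Q(z,\chi,\tau))$ with $a$ an invertible $d\times d$ matrix of power series and $Q_j(0,\chi,\tau)=Q_j(z,0,\tau)=\tau_j$. Write $Q^j(z,\chi,0)=\sum_\alpha q^j_\alpha(\chi)z^\alpha$ and let $I_M\subset\mathbb C[[\chi]]$ be the ideal generated by all the $q^j_\alpha$. Then $M$ is essentially finite at $0$ if $\dim_{\mathbb C}\mathbb C[[\chi]]/I_M<\infty$, and this dimension is then denoted $\mathrm{Ess}_0(M)$. Let $M,\widetilde M$ be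 formal generic submanifolds of codimension $d$ through $0\in\mathbb C^N$, with defining series $\rho,\tilde\rho$, and let $H\colon(\mathbb C^N,0)\to(\mathbb C^N,0)$ be a formal holomorphic mapping ($H\in\mathbb C[[Z]]^N$, $H(0)=0$) sending $M$ into $\widetilde M$, i.e. $\tilde\rho(H(Z),\bar H(\zeta))=c(Z,\zeta)\rho(Z,\zeta)$ for some $d\times d$ matrix $c$ of formal power series. Assume that $H$ is CR transversal to $\widetilde M$ at $0$, i.e. $T^{1,0}_0\widetilde M+dH(T^{1,0}_0\mathbb C^N)=T^{1,0}_0\mathbb C^N$, where $T^{1,0}_0\widetilde M=\{v\in\mathbb C^N:\sum_k v_k\,\partial\tilde\rho_j/\partial Z_k(0)=0,\ j=1,\dots,d\}$ under the identification $T^{1,0}_0\mathbb C^N=\mathbb C^N$. Fix any normal coordinates $(z,w)$ for $M$ and $(\tilde z,\tilde w)$ for $\widetilde M$, and write $H=(F,G)$ in these coordinates. Say that $H$ is Segre finite if $\dim_{\mathbb C}\mathbb C[[z]]/I(F(z,0))<\infty$, where $I(F(z,0))$ is the ideal generated by the components of $F(z,0)$, and then denote this dimension by $m_H$. Then, with all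 notions computed in the chosen normal coordinates: (1) if $M$ is essentially finite at $0$, then $\widetilde M$ is essentially finite at $0$, $H$ is Segre finite, and $\mathrm{Ess}_0(M)=m_H\,\mathrm{Ess}_0(\widetilde M)$; (2) if $\widetilde M$ is essentially finite at $0$ and $H$ is Segre finite, then $M$ is essentially finite at $0$ and $\mathrm{Ess}_0(M)=m_H\,\mathrm{Ess}_0(\widetilde M)$. -/

import Mathlib

noncomputable section

/-- The series obtained by replacing each coefficient by its complex conjugate. -/
def conjSeries {σ : Type} (f : MvPowerSeries σ ℂ) : MvPowerSeries σ ℂ :=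
  MvPowerSeries.map (starRingEnd ℂ) f

/-- A formal holomorphic mapping `(ℂ^σ, 0) → (ℂ^τ, 0)`: a tuple of formal power series in the
variables `σ`, indexed by `τ`, without constant terms. -/
@[ext]
structure FormalMap (σ τ : Type) where
  toSeries : τ → MvPowerSeries σ ℂ
  constantCoeff_eq_zero : ∀ k, MvPowerSeries.constantCoeff (toSeries k) = 0

namespace FormalMap

theorem hasSubst {σ τ : Type} [Finite τ] (f : FormalMap σ τ) :
    MvPowerSeries.HasSubst f.toSeries :=
  MvPowerSeries.hasSubst_of_constantCoeff_zero f.constantCoeff_eq_zero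

/-- The identity mapping. -/
def id (σ : Type) : FormalMap σ σ where
  toSeries k := MvPowerSeries.X k
  constantCoeff_eq_zero k := MvPowerSeries.constantCoeff_X k

/-- The composition `g ∘ f`, given by substitution of `f` into the components of `g`. -/
def comp {σ τ υ : Type} [Finite τ] (g : FormalMap τ υ) (f : FormalMap σ τ) : FormalMap σ υ where
  toSeries k := MvPowerSeries.subst f.toSeries (g.toSeries k)
  constantCoeff_eq_zero k :=
    MvPowerSeries.constantCoeff_subst_eq_zero f.hasSubst f.constantCoeff_eq_zero
      (g.constantCoeff_eq_zero k)

/-- The complexification `(Z, ζ) ↦ (H(Z), H̄(ζ))`. The left summand indexes the variables `Z` and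
the right summand the variables `ζ` that formally replace the conjugates of `Z`. -/
def double {σ τ : Type} (H : FormalMap σ τ) : τ ⊕ τ → MvPowerSeries (σ ⊕ σ) ℂ :=
  Sum.elim
    (fun k => MvPowerSeries.subst
      (fun i => (MvPowerSeries.X (Sum.inl i) : MvPowerSeries (σ ⊕ σ) ℂ)) (H.toSeries k))
    (fun k => MvPowerSeries.subst
      (fun i => (MvPowerSeries.X (Sum.inr i) : MvPowerSeries (σ ⊕ σ) ℂ))
      (conjSeries (H.toSeries k)))

/-- The differential `dH : T^{1,0}_0 → T^{1,0}_0` at the origin, in the bases `∂/∂Z_i`. -/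
def differential {σ τ : Type} [Fintype σ] (H : FormalMap σ τ) : (σ → ℂ) →ₗ[ℂ] (τ → ℂ) :=
  Matrix.mulVecLin
    (Matrix.of fun k i => MvPowerSeries.coeff (Finsupp.single i 1) (H.toSeries k))

end FormalMap

/-- A formal generic (real) submanifold of codimension `d` through `0` in `ℂ^N`, given by defining
series `ρ(Z, ζ)`; the variables `Z` are indexed by the left and `ζ` by the right summand. -/
structure FormalGenericSubmanifold (N d : ℕ) where
  rho : Fin d → MvPowerSeries (Fin N ⊕ Fin N) ℂ
  /-- `ρ(Z, ζ) = ρ̄(ζ, Z)` -/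
  reality : ∀ j, rho j = MvPowerSeries.subst
    (fun i => (MvPowerSeries.X i.swap : MvPowerSeries (Fin N ⊕ Fin N) ℂ)) (conjSeries (rho j))
  constantCoeff_eq_zero : ∀ j, MvPowerSeries.constantCoeff (rho j) = 0
  /-- `∂_Z ρ_1(0) ∧ … ∧ ∂_Z ρ_d(0) ≠ 0` -/
  generic : LinearIndependent ℂ fun (j : Fin d) (k : Fin N) =>
    MvPowerSeries.coeff (Finsupp.single (Sum.inl k) 1) (rho j)

/-- `T^{1,0}_0 M`: the vectors `∑ v_k ∂/∂Z_k` at the origin that annihilate `ρ_1, …, ρ_d`. -/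
def FormalGenericSubmanifold.holTangent {N d : ℕ} (M : FormalGenericSubmanifold N d) :
    Submodule ℂ (Fin N → ℂ) :=
  LinearMap.ker (Matrix.mulVecLin (Matrix.of fun (j : Fin d) (k : Fin N) =>
    MvPowerSeries.coeff (Finsupp.single (Sum.inl k) 1) (M.rho j)))

/-- `H(M) ⊂ M'`: one has `ρ'(H(Z), H̄(ζ)) = c(Z, ζ) ρ(Z, ζ)` for some `d × d` matrix `c` of formal
power series. -/
def FormalMap.MapsInto {N d : ℕ} (H : FormalMap (Fin N) (Fin N))
    (M M' : FormalGenericSubmanifold N d) : Prop :=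
  ∃ c : Matrix (Fin d) (Fin d) (MvPowerSeries (Fin N ⊕ Fin N) ℂ),
    ∀ j, MvPowerSeries.subst H.double (M'.rho j) = ∑ k, c j k * M.rho k

/-- `H` is CR transversal to `M'` at `0`: `T^{1,0}_0 M' + dH(T^{1,0}_0 ℂ^N) = T^{1,0}_0 ℂ^N`. -/
def FormalMap.IsCRTransversal {N d : ℕ} (H : FormalMap (Fin N) (Fin N))
    (M' : FormalGenericSubmanifold N d) : Prop :=
  M'.holTangent ⊔ LinearMap.range H.differential = ⊤

/-- Normal coordinates for `M` at `0`. The coordinates `(z, w)` are indexed by `Fin n ⊕ Fin d`, and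
the series `Q(z, χ, τ)` has its variables `(z, (χ, τ))` indexed by `Fin n ⊕ (Fin n ⊕ Fin d)`. -/
structure NormalCoordinates {n d : ℕ} (M : FormalGenericSubmanifold (n + d) d) where
  /-- the formal change of coordinates `Z = Z(z, w)` -/
  coord : FormalMap (Fin n ⊕ Fin d) (Fin (n + d))
  /-- its formal inverse `(z, w) = (z, w)(Z)` -/
  inv : FormalMap (Fin (n + d)) (Fin n ⊕ Fin d)
  coord_comp_inv : coord.comp inv = FormalMap.id _
  inv_comp_coord : inv.comp coord = FormalMap.id _
  Q : Fin d → MvPowerSeries (Fin n ⊕ (Fin n ⊕ Fin d)) ℂ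
  /-- `ρ(Z(z, w), Z̄(χ, τ)) = a(z, w, χ, τ) (w - Q(z, χ, τ))` with an invertible matrix `a` -/
  defining : ∃ a : Matrix (Fin d) (Fin d)
      (MvPowerSeries ((Fin n ⊕ Fin d) ⊕ (Fin n ⊕ Fin d)) ℂ), IsUnit a ∧
    ∀ j, MvPowerSeries.subst coord.double (M.rho j) =
      ∑ k, a j k * (MvPowerSeries.X (Sum.inl (Sum.inr k)) -
        MvPowerSeries.subst (Sum.elim
          (fun i => (MvPowerSeries.X (Sum.inl (Sum.inl i)) :
            MvPowerSeries ((Fin n ⊕ Fin d) ⊕ (Fin n ⊕ Fin d)) ℂ))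
          (fun i => MvPowerSeries.X (Sum.inr i))) (Q k))
  /-- `Q_j(0, χ, τ) = τ_j` -/
  normal_left : ∀ j, MvPowerSeries.subst (Sum.elim (fun _ => 0)
    (fun i => (MvPowerSeries.X i : MvPowerSeries (Fin n ⊕ Fin d) ℂ))) (Q j) =
      MvPowerSeries.X (Sum.inr j)
  /-- `Q_j(z, 0, τ) = τ_j` -/
  normal_right : ∀ j, MvPowerSeries.subst (Sum.elim
    (fun i => (MvPowerSeries.X (Sum.inl i) : MvPowerSeries (Fin n ⊕ Fin d) ℂ))
    (Sum.elim (fun _ => 0) (fun k => MvPowerSeries.X (Sum.inr k)))) (Q j) =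
      MvPowerSeries.X (Sum.inr j)

namespace NormalCoordinates

variable {n d : ℕ} {M M' : FormalGenericSubmanifold (n + d) d}

/-- The series `q^j_α(χ)` in the expansion `Q^j(z, χ, 0) = ∑_α q^j_α(χ) z^α`. -/
def qCoeff (x : NormalCoordinates M) (j : Fin d) (α : Fin n →₀ ℕ) : MvPowerSeries (Fin n) ℂ :=
  fun β => MvPowerSeries.coeff (Finsupp.sumElim α (Finsupp.sumElim β 0)) (x.Q j)

/-- The essential ideal `I_M`, generated by all the `q^j_α(χ)`. -/
def essentialIdeal (x : NormalCoordinates M) : Ideal (MvPowerSeries (Fin n) ℂ) :=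
  Ideal.span {f | ∃ j α, f = x.qCoeff j α}

/-- `M` is essentially finite at `0`: the essential ideal has finite codimension. -/
def IsEssentiallyFinite (x : NormalCoordinates M) : Prop :=
  Module.Finite ℂ (MvPowerSeries (Fin n) ℂ ⧸ x.essentialIdeal)

/-- The essential type `Ess_0(M)`, i.e. the codimension of the essential ideal; it is meaningful
when `M` is essentially finite. -/
def essentialType (x : NormalCoordinates M) : ℕ :=
  Module.finrank ℂ (MvPowerSeries (Fin n) ℂ ⧸ x.essentialIdeal)

/-- The mapping `H`, written as `(F, G)` in the normal coordinates `x` (source) and `x'`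
(target). -/
def express (x : NormalCoordinates M) (x' : NormalCoordinates M')
    (H : FormalMap (Fin (n + d)) (Fin (n + d))) : FormalMap (Fin n ⊕ Fin d) (Fin n ⊕ Fin d) :=
  x'.inv.comp (H.comp x.coord)

/-- The components of `F(z, 0)`, the mapping induced by `H` between the Segre varieties. -/
def segreSeries (x : NormalCoordinates M) (x' : NormalCoordinates M')
    (H : FormalMap (Fin (n + d)) (Fin (n + d))) (i : Fin n) : MvPowerSeries (Fin n) ℂ :=
  MvPowerSeries.subst (Sum.elim
    (fun k => (MvPowerSeries.X k : MvPowerSeries (Fin n) ℂ)) (fun _ => 0))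
    ((express x x' H).toSeries (Sum.inl i))

/-- The ideal `I(F(z, 0))`. -/
def segreIdeal (x : NormalCoordinates M) (x' : NormalCoordinates M')
    (H : FormalMap (Fin (n + d)) (Fin (n + d))) : Ideal (MvPowerSeries (Fin n) ℂ) :=
  Ideal.span (Set.range (segreSeries x x' H))

/-- `H` is Segre finite: the formal mapping `z ↦ F(z, 0)` is finite. -/
def IsSegreFinite (x : NormalCoordinates M) (x' : NormalCoordinates M')
    (H : FormalMap (Fin (n + d)) (Fin (n + d))) : Prop :=
  Module.Finite ℂ (MvPowerSeries (Fin n) ℂ ⧸ segreIdeal x x' H)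

/-- The integer `m_H = dim ℂ⟦z⟧ / I(F(z, 0))`; it is meaningful when `H` is Segre finite. -/
def segreMultiplicity (x : NormalCoordinates M) (x' : NormalCoordinates M')
    (H : FormalMap (Fin (n + d)) (Fin (n + d))) : ℕ :=
  Module.finrank ℂ (MvPowerSeries (Fin n) ℂ ⧸ segreIdeal x x' H)

end NormalCoordinates

end

/-!
At `ζ = 0`, normality of the coordinates turns the inclusion `H(M) ⊂ M'` into `G = B w` for a
matrix `B` of power series, and CR transversality makes `B` invertible. Restricted to the points
`(z, Q(z, χ, 0), χ, 0)` of `M`, the inclusion therefore says that the series `Q(z, χ, 0)` and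
`Q'(F(z, Q(z, χ, 0)), F̄(χ, 0), 0)` generate the same ideal. Hence `I_M` is contained in the ideal
generated by the pullback of `I_{M'}` under `χ ↦ F̄(χ, 0)`, so that `H` is Segre finite if `M` is
essentially finite.

Conversely, modulo `I_M` the second family is `Q'(F(z, 0), F̄(χ, 0), 0)`. If `z ↦ F(z, 0)` is
finite, then it makes `ℂ⟦z⟧` a free module over itself, because a system of parameters of a
Cohen-Macaulay module is a regular sequence; by faithful flatness the coefficients of
`Q'(z, F̄(χ, 0), 0)` already lie in `I_M`. So `I_M` is generated by the pullback of `I_{M'}`, and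
since the pullback by `χ ↦ F̄(χ, 0)` is also free, of rank `m_H`, the codimension of `I_M` is `m_H`
times that of `I_{M'}`.
-/

universe u

section Depth

open IsLocalRing RingTheory.Sequence
open scoped Pointwise

section

variable {R M : Type*} [CommRing R] [IsLocalRing R] [IsNoetherianRing R] [AddCommGroup M]
  [Module R M] [Module.Finite R M]

-- Nakayama: if the `p`-torsion were contained in `x • M`, it would be equal to `x` times itself.
theorem exists_mem_torsionBySet_notMem_smul_top {x : R} (hxm : x ∈ maximalIdeal R)
    (hx : IsSMulRegular M x) {p : Ideal R} (hp : Submodule.torsionBySet R M p ≠ ⊥) :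
    ∃ v ∈ Submodule.torsionBySet R M p, v ∉ x • (⊤ : Submodule R M) := by
  by_contra! hcon
  refine hp (Submodule.eq_bot_of_le_smul_of_le_jacobson_bot (Ideal.span {x}) _
    (IsNoetherian.noetherian _) (fun v hv => ?_) ?_)
  · obtain ⟨w, -, rfl⟩ := (Submodule.mem_smul_pointwise_iff_exists _ _ _).mp (hcon v hv)
    refine Submodule.smul_mem_smul (Ideal.mem_span_singleton_self x) ?_
    rw [Submodule.mem_torsionBySet_iff] at hv ⊢
    exact fun a => hx.right_eq_zero_of_smul (by rw [smul_comm, hv a])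
  · rw [jacobson_eq_maximalIdeal ⊥ bot_ne_top]
    exact (Ideal.span_singleton_le_iff_mem _).mpr hxm

theorem exists_isAssociatedPrime_quotSMulTop {x : R} (hxm : x ∈ maximalIdeal R)
    (hx : IsSMulRegular M x) {p : Ideal R} (hp : IsAssociatedPrime p M) :
    ∃ q : Ideal R, IsAssociatedPrime q (QuotSMulTop x M) ∧ p ≤ q ∧ x ∈ q := by
  obtain ⟨hpp, u, hu⟩ := isAssociatedPrime_iff.mp hp
  have hu_mem : u ∈ Submodule.torsionBySet R M p := by
    rw [Submodule.mem_torsionBySet_iff]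
    rintro ⟨a, ha⟩
    simpa [hu, Submodule.mem_colon_singleton] using ha
  have hu_ne : u ≠ 0 := by
    rintro rfl
    exact hpp.ne_top (by simp [hu, Ideal.eq_top_iff_one, Submodule.mem_colon_singleton])
  obtain ⟨v, hv, hvx⟩ := exists_mem_torsionBySet_notMem_smul_top hxm hx
    ((Submodule.ne_bot_iff _).mpr ⟨u, hu_mem, hu_ne⟩)
  obtain ⟨q, hq, hle⟩ := exists_le_isAssociatedPrime_of_isNoetherianRing R
    (Submodule.Quotient.mk v : QuotSMulTop x M) (by rwa [Ne, Submodule.Quotient.mk_eq_zero])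
  refine ⟨q, hq, fun a ha => hle ?_, hle ?_⟩
  · rw [Submodule.mem_colon_singleton, ← Submodule.Quotient.mk_smul,
      (Submodule.mem_torsionBySet_iff _ _).mp hv ⟨a, ha⟩]
    simp
  · rw [Submodule.mem_colon_singleton, ← Submodule.Quotient.mk_smul, Submodule.mem_bot,
      Submodule.Quotient.mk_eq_zero]
    exact Submodule.smul_mem_pointwise_smul v x ⊤ trivial

end

theorem notMem_of_isSMulRegular_of_isAssociatedPrime {R M : Type*} [CommRing R]
    [IsNoetherianRing R] [AddCommGroup M] [Module R M] {x : R} (hx : IsSMulRegular M x)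
    {p : Ideal R} (hp : IsAssociatedPrime p M) : x ∉ p := fun hxp => by
  have : x ∈ ⋃ q ∈ associatedPrimes R M, (q : Set R) := Set.mem_biUnion hp hxp
  rw [biUnion_associatedPrimes_eq_compl_regular] at this
  exact this hx

theorem length_le_ringKrullDim_quotient_of_isAssociatedPrime {R : Type*} [CommRing R]
    [IsLocalRing R] [IsNoetherianRing R] (rs : List R) (hrs : ∀ r ∈ rs, r ∈ maximalIdeal R)
    {M : Type*} [AddCommGroup M] [Module R M] [Module.Finite R M] (hreg : IsWeaklyRegular M rs)
    {p : Ideal R} (hp : IsAssociatedPrime p M) :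
    (rs.length : WithBot ℕ∞) ≤ ringKrullDim (R ⧸ p) := by
  induction rs generalizing M p with
  | nil =>
    have := hp.isPrime
    simpa using ringKrullDim_nonneg_of_nontrivial
  | cons x rs ih =>
    rw [isWeaklyRegular_cons_iff] at hreg
    obtain ⟨q, hq, hpq, hxq⟩ :=
      exists_isAssociatedPrime_quotSMulTop (hrs x List.mem_cons_self) hreg.1 hp
    have := hp.isPrime
    have hxp : Ideal.Quotient.mk p x ∈ nonZeroDivisors (R ⧸ p) :=
      mem_nonZeroDivisors_of_ne_zero fun h =>
        notMem_of_isSMulRegular_of_isAssociatedPrime hreg.1 hp (Ideal.Quotient.eq_zero_iff_mem.mp h)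
    have hdim : ringKrullDim (R ⧸ q) + 1 ≤ ringKrullDim (R ⧸ p) :=
      ringKrullDim_succ_le_of_surjective (Ideal.Quotient.factor hpq)
        (Ideal.Quotient.factor_surjective hpq) hxp
        (by simpa [Ideal.Quotient.eq_zero_iff_mem] using hxq)
    refine le_trans ?_ hdim
    push_cast [List.length_cons]
    gcongr
    exact ih (fun r hr => hrs r (List.mem_cons_of_mem _ hr)) hreg.2 hq

section

variable {R : Type*} [CommRing R] (M : Type*) [AddCommGroup M] [Module R M]

theorem annihilator_sup_ofList_cons_le (y : R) (ys : List R) :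
    Module.annihilator R M ⊔ Ideal.ofList (y :: ys) ≤
      Module.annihilator R (QuotSMulTop y M) ⊔ Ideal.ofList ys := by
  rw [Ideal.ofList_cons]
  refine sup_le (le_sup_of_le_left
    (LinearMap.annihilator_le_of_surjective _ (Submodule.mkQ_surjective _)))
    (sup_le_sup_right ((Ideal.span_singleton_le_iff_mem _).mpr (Module.mem_annihilator.mpr ?_)) _)
  intro m
  obtain ⟨m, rfl⟩ := Submodule.mkQ_surjective _ m
  rw [← map_smul, Submodule.mkQ_apply, Submodule.Quotient.mk_eq_zero]
  exact Submodule.smul_mem_pointwise_smul m y ⊤ trivial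

variable [IsLocalRing R]

theorem supportDim_le_zero_of_maximalIdeal_le_radical [Module.Finite R M]
    (h : maximalIdeal R ≤ (Module.annihilator R M).radical) : Module.supportDim R M ≤ 0 := by
  have : Subsingleton (Module.support R M) := by
    suffices ∀ p ∈ Module.support R M, p.asIdeal = maximalIdeal R from
      ⟨fun p q => Subtype.ext (PrimeSpectrum.ext ((this p p.2).trans (this q q.2).symm))⟩
    intro p hp
    rw [Module.support_eq_zeroLocus, PrimeSpectrum.mem_zeroLocus] at hp
    exact le_antisymm (le_maximalIdeal p.2.ne_top) (h.trans (p.2.radical_le_iff.mpr hp))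
  exact Order.krullDim_nonpos_of_subsingleton

theorem supportDim_le_length [IsNoetherianRing R] [Module.Finite R M] (ys : List R)
    (hys : ∀ y ∈ ys, y ∈ maximalIdeal R)
    (hrad : maximalIdeal R ≤ (Module.annihilator R M ⊔ Ideal.ofList ys).radical) :
    Module.supportDim R M ≤ ys.length := by
  induction ys generalizing M with
  | nil => exact supportDim_le_zero_of_maximalIdeal_le_radical M (by simpa using hrad)
  | cons y ys ih =>
    refine (Module.supportDim_le_supportDim_quotSMulTop_succ (hys y List.mem_cons_self)).trans ?_
    push_cast [List.length_cons]
    gcongr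
    exact ih (QuotSMulTop y M) (fun r hr => hys r (List.mem_cons_of_mem _ hr))
      (hrad.trans (Ideal.radical_mono (annihilator_sup_ofList_cons_le M y ys)))

end

section

variable {R : Type u} [CommRing R] [IsLocalRing R]

/-- The depth of `M` over a local ring is at least `n`: there is an `M`-regular sequence of
length `n`. -/
def HasDepthAtLeast (R M : Type*) [CommRing R] [IsLocalRing R] [AddCommGroup M] [Module R M]
    (n : ℕ) : Prop :=
  ∃ rs : List R, rs.length = n ∧ (∀ r ∈ rs, r ∈ maximalIdeal R) ∧ IsRegular M rs

theorem maximalIdeal_smul_top_lt_top (L : Type*) [AddCommGroup L] [Module R L] [Module.Finite R L]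
    [Nontrivial L] : maximalIdeal R • (⊤ : Submodule R L) < ⊤ :=
  (Submodule.top_ne_ideal_smul_of_le_jacobson_annihilator
    (maximalIdeal_le_jacobson _)).symm.lt_top

variable [IsNoetherianRing R] {M : Type u} [AddCommGroup M] [Module R M] [Module.Finite R M]

-- Depth is detected by the vanishing of `Ext (R ⧸ maximalIdeal R) _ i`, which passes to `M / y M`
-- along the long exact sequence, whereas a regular sequence on `M` need not start with `y`.
open CategoryTheory Abelian in
theorem HasDepthAtLeast.quotSMulTop {n : ℕ} (h : HasDepthAtLeast R M (n + 1)) {y : R}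
    (hym : y ∈ maximalIdeal R) (hy : IsSMulRegular M y) :
    HasDepthAtLeast R (QuotSMulTop y M) n := by
  obtain ⟨rs, hlen, hmem, hreg⟩ := h
  have := hreg.nontrivial
  have : Nontrivial (QuotSMulTop y M) := nontrivial_quotSMulTop_of_mem_maximalIdeal _ hym
  let κ := ModuleCat.of R (R ⧸ maximalIdeal R)
  have hsupp : Module.support R κ = PrimeSpectrum.zeroLocus (maximalIdeal R : Set R) :=
    (Module.support_eq_zeroLocus ..).trans (by rw [Ideal.annihilator_quotient])
  have hext := ModuleCat.subsingleton_ext_of_exists_isRegular (maximalIdeal R) κ hsupp.subset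
    (ModuleCat.of R M) (maximalIdeal_smul_top_lt_top M) rs hmem hreg
  refine ModuleCat.exists_isRegular_of_exists_subsingleton_ext (maximalIdeal R) n
    (ModuleCat.of R (QuotSMulTop y M)) (maximalIdeal_smul_top_lt_top _) κ hsupp fun i hi => ?_
  have hy' : IsSMulRegular (ModuleCat.of R M) y := hy
  exact AddCommGrpCat.subsingleton_of_isZero <| ShortComplex.Exact.isZero_of_both_zeros
    ((Ext.covariant_sequence_exact₃' κ hy'.smulShortComplex_shortExact) i (i + 1) rfl)
    ((AddCommGrpCat.isZero_of_iff_subsingleton.mpr (hext i (by omega))).eq_zero_of_src _)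
    ((AddCommGrpCat.isZero_of_iff_subsingleton.mpr (hext (i + 1) (by omega))).eq_zero_of_tgt _)

theorem isSMulRegular_of_maximalIdeal_le_radical {y : R} {ys : List R}
    (hys : ∀ y ∈ ys, y ∈ maximalIdeal R) (hdepth : HasDepthAtLeast R M (ys.length + 1))
    (hrad : maximalIdeal R ≤ (Module.annihilator R M ⊔ Ideal.ofList (y :: ys)).radical) :
    IsSMulRegular M y := by
  by_contra hy
  have hy' : y ∈ ⋃ p ∈ associatedPrimes R M, (p : Set R) := by
    rwa [biUnion_associatedPrimes_eq_compl_regular]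
  obtain ⟨p, hp, hyp⟩ := Set.mem_iUnion₂.mp hy'
  obtain ⟨rs, hlen, hmem, hreg⟩ := hdepth
  have hlower : ((ys.length + 1 : ℕ) : WithBot ℕ∞) ≤ ringKrullDim (R ⧸ p) :=
    hlen ▸ length_le_ringKrullDim_quotient_of_isAssociatedPrime rs hmem hreg.toIsWeaklyRegular hp
  have hupper : ringKrullDim (R ⧸ p) ≤ ys.length := by
    rw [← Module.supportDim_quotient_eq_ringKrullDim]
    refine supportDim_le_length (R ⧸ p) ys hys (hrad.trans (Ideal.radical_mono ?_))
    rw [Ideal.annihilator_quotient, Ideal.ofList_cons]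
    exact sup_le
      (le_sup_of_le_left
        (Submodule.annihilator_top.symm.trans_le (IsAssociatedPrime.annihilator_le hp)))
      (sup_le_sup_right ((Ideal.span_singleton_le_iff_mem _).mpr hyp) _)
  have : ys.length + 1 ≤ ys.length := by exact_mod_cast hlower.trans hupper
  omega

/-- A system of parameters of a Cohen-Macaulay module is a regular sequence. -/
theorem isWeaklyRegular_of_maximalIdeal_le_radical {ys : List R}
    (hys : ∀ y ∈ ys, y ∈ maximalIdeal R) (hdepth : HasDepthAtLeast R M ys.length)
    (hrad : maximalIdeal R ≤ (Module.annihilator R M ⊔ Ideal.ofList ys).radical) :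
    IsWeaklyRegular M ys := by
  induction ys generalizing M with
  | nil => exact .nil _ _
  | cons y ys ih =>
    have hys' : ∀ y ∈ ys, y ∈ maximalIdeal R := fun r hr => hys r (List.mem_cons_of_mem _ hr)
    have hy : IsSMulRegular M y := isSMulRegular_of_maximalIdeal_le_radical hys' hdepth hrad
    exact (isWeaklyRegular_cons_iff ..).mpr ⟨hy,
      ih hys' (hdepth.quotSMulTop (hys y List.mem_cons_self) hy)
        (hrad.trans (Ideal.radical_mono (annihilator_sup_ofList_cons_le M y ys)))⟩

end

theorem isWeaklyRegular_quotient_of_cons {R : Type*} [CommRing R] {x : R} {rs : List R}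
    (h : IsWeaklyRegular R (x :: rs)) :
    IsWeaklyRegular (R ⧸ Ideal.span {x}) (rs.map (Ideal.Quotient.mk (Ideal.span {x}))) := by
  let e : QuotSMulTop x R ≃ₗ[R] (R ⧸ Ideal.span {x}) :=
    Submodule.quotEquivOfEq _ _ (by simp [← Submodule.ideal_span_singleton_smul])
  exact ((e.extendScalarsOfSurjective Ideal.Quotient.mk_surjective).isWeaklyRegular_congr _).mp
    ((isWeaklyRegular_cons_iff' ..).mp h).2

theorem free_of_isWeaklyRegular {R M : Type u} [CommRing R] [IsLocalRing R]
    [IsNoetherianRing R] [AddCommGroup M] [Module R M] [Module.Finite R M] {rs : List R}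
    (hrs : Ideal.ofList rs = maximalIdeal R) (hR : IsWeaklyRegular R rs)
    (hM : IsWeaklyRegular M rs) : Module.Free R M := by
  obtain ⟨n, hlen⟩ : ∃ n, rs.length = n := ⟨_, rfl⟩
  induction n generalizing R M with
  | zero =>
    obtain rfl := List.length_eq_zero_iff.mp hlen
    let := (isField_iff_maximalIdeal_eq.mpr (by simpa using hrs.symm) : IsField R).toField
    exact Module.Free.of_divisionRing R M
  | succ n ih =>
    obtain ⟨x, rs, rfl⟩ := List.exists_cons_of_length_eq_add_one hlen
    have hxm : x ∈ maximalIdeal R := hrs ▸ Ideal.subset_span List.mem_cons_self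
    have : Nontrivial (R ⧸ Ideal.span {x}) :=
      Ideal.Quotient.nontrivial_iff.mpr fun h => hxm (Ideal.span_singleton_eq_top.mp h)
    have : IsLocalRing (R ⧸ Ideal.span {x}) :=
      .of_surjective' (Ideal.Quotient.mk _) Ideal.Quotient.mk_surjective
    have : Module.FinitePresentation R M := Module.finitePresentation_of_finite R M
    have : Module.Finite (R ⧸ Ideal.span {x}) (QuotSMulTop x M) :=
      Module.Finite.of_restrictScalars_finite R _ _
    rw [isWeaklyRegular_cons_iff'] at hM
    rw [← Module.free_quotSMulTop_iff_free R M
      (by rwa [jacobson_eq_maximalIdeal ⊥ bot_ne_top]) hM.1]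
    refine ih ?_ (isWeaklyRegular_quotient_of_cons hR) hM.2 (by simpa using hlen)
    rw [← map_maximalIdeal_of_surjective _ Ideal.Quotient.mk_surjective, ← hrs, Ideal.ofList_cons,
      Ideal.map_sup, ← Ideal.map_ofList]
    simp

end Depth

section Completeness

variable {R ι : Type*} [CommRing R] [Finite ι]

theorem mem_smul_top_of_forall_mem {J : Ideal R} {v : ι → R} (hv : ∀ i, v i ∈ J) :
    v ∈ J • (⊤ : Submodule R (ι → R)) := by
  classical
  have := Fintype.ofFinite ι
  rw [pi_eq_sum_univ' v]
  exact Submodule.sum_mem _ fun i _ => Submodule.smul_mem_smul (hv i) trivial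

theorem isPrecomplete_pi (I : Ideal R) [IsPrecomplete I R] : IsPrecomplete I (ι → R) := by
  refine ⟨fun f hf => ?_⟩
  have h : ∀ i, ∃ L : R, ∀ n, f n i ≡ L [SMOD I ^ n • (⊤ : Submodule R R)] := fun i =>
    IsPrecomplete.prec' (fun n => f n i) fun {m n} hmn =>
      ((hf hmn).map (LinearMap.proj (R := R) (φ := fun _ : ι => R) i)).mono
        (by rw [Submodule.map_smul'']; exact Submodule.smul_mono le_rfl le_top)
  choose L hL using h
  refine ⟨L, fun n => SModEq.sub_mem.mpr (mem_smul_top_of_forall_mem fun i => ?_)⟩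
  simpa [SModEq.sub_mem] using hL i n

theorem finite_of_finite_quotient_smul_top {M : Type*} [AddCommGroup M] [Module R M] (I : Ideal R)
    [IsPrecomplete I R] [IsHausdorff I M] [Module.Finite R (M ⧸ I • (⊤ : Submodule R M))] :
    Module.Finite R M := by
  obtain ⟨n, g, hg⟩ := Module.Finite.exists_fin' R (M ⧸ I • (⊤ : Submodule R M))
  obtain ⟨f, hf⟩ := Module.projective_lifting_property (Submodule.mkQ (I • (⊤ : Submodule R M))) g
    (Submodule.mkQ_surjective _)
  have := isPrecomplete_pi (ι := Fin n) I
  exact Module.Finite.of_surjective f (surjective_of_mkQ_comp_surjective (I := I) (by rwa [hf]))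

end Completeness

section CodimensionOfExtension

open scoped TensorProduct

variable {A B : Type*} [CommRing A] [CommRing B] [Algebra A B] (I : Ideal A)

theorem nonempty_quotTensor_equiv_quotient_map :
    Nonempty ((A ⧸ I) ⊗[A] B ≃ₗ[A ⧸ I] B ⧸ I.map (algebraMap A B)) :=
  ⟨(TensorProduct.quotTensorEquivQuotSMul B I ≪≫ₗ
    Submodule.quotEquivOfEq _ _ (Ideal.smul_top_eq_map I) ≪≫ₗ
    Submodule.Quotient.restrictScalarsEquiv A _).extendScalarsOfSurjective
      Ideal.Quotient.mk_surjective⟩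

theorem free_quotient_map [Module.Free A B] :
    Module.Free (A ⧸ I) (B ⧸ I.map (algebraMap A B)) :=
  (nonempty_quotTensor_equiv_quotient_map I).elim fun e => .of_equiv e

theorem finrank_quotient_map_eq_finrank [Module.Free A B] (hI : I ≠ ⊤) :
    Module.finrank (A ⧸ I) (B ⧸ I.map (algebraMap A B)) = Module.finrank A B := by
  have : Nontrivial (A ⧸ I) := Ideal.Quotient.nontrivial_iff.mpr hI
  have : Nontrivial A := (Ideal.Quotient.mk I).domain_nontrivial
  obtain ⟨e⟩ := nonempty_quotTensor_equiv_quotient_map (B := B) I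
  rw [← e.finrank_eq, Module.finrank_baseChange]

variable (k : Type*) [Field k] [Algebra k A] [Algebra k B] [IsScalarTower k A B]

theorem isScalarTower_quotient_map :
    IsScalarTower k (A ⧸ I) (B ⧸ I.map (algebraMap A B)) :=
  .of_algebraMap_eq fun r =>
    congrArg (Ideal.Quotient.mk _) (IsScalarTower.algebraMap_apply k A B r)

theorem finrank_quotient_map_eq_mul [Module.Free A B] :
    Module.finrank k (B ⧸ I.map (algebraMap A B)) =
      Module.finrank A B * Module.finrank k (A ⧸ I) := by
  obtain rfl | hI := eq_or_ne I ⊤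
  · rw [Ideal.map_top]
    simp [Module.finrank_zero_of_subsingleton]
  · have := isScalarTower_quotient_map (B := B) I k
    have := free_quotient_map (B := B) I
    have : Nontrivial (A ⧸ I) := Ideal.Quotient.nontrivial_iff.mpr hI
    rw [← finrank_quotient_map_eq_finrank I hI, mul_comm, Module.finrank_mul_finrank]

theorem finite_quotient_map_iff [Module.Finite A B] [Module.FaithfullyFlat A B] :
    Module.Finite k (B ⧸ I.map (algebraMap A B)) ↔ Module.Finite k (A ⧸ I) := by
  refine ⟨fun _ => ?_, fun _ => ?_⟩
  · refine .of_injective (Ideal.quotientMapₐ (I.map (algebraMap A B))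
      (IsScalarTower.toAlgHom k A B) Ideal.le_comap_map).toLinearMap
      (Ideal.quotientMap_injective' (H := Ideal.le_comap_map) ?_)
    exact (Ideal.comap_map_eq_self_of_faithfullyFlat I).le
  · have := isScalarTower_quotient_map (B := B) I k
    have : Module.Finite (A ⧸ I) (B ⧸ I.map (algebraMap A B)) :=
      Module.Finite.of_restrictScalars_finite A _ _
    exact Module.Finite.trans (A ⧸ I) _

end CodimensionOfExtension

open MvPowerSeries

section VariableIdeals

variable {σ R : Type*} [CommRing R]

theorem coeff_eq_zero_of_mem_span_X_image {s : Set σ} {f : MvPowerSeries σ R}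
    (hf : f ∈ Ideal.span ((X : σ → MvPowerSeries σ R) '' s)) {e : σ →₀ ℕ}
    (he : ∀ j ∈ s, e j = 0) : coeff e f = 0 := by
  classical
  induction hf using Submodule.span_induction generalizing e with
  | mem x hx =>
    obtain ⟨j, hj, rfl⟩ := hx
    rw [coeff_X, if_neg]
    rintro rfl
    simpa using he j hj
  | zero => simp
  | add x y _ _ hx hy => rw [map_add, hx he, hy he, add_zero]
  | smul a x _ hx =>
    rw [smul_eq_mul, coeff_mul]
    refine Finset.sum_eq_zero fun p hp => ?_
    rw [hx fun j hj => ?_, mul_zero]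
    have hadd := DFunLike.congr_fun (Finset.HasAntidiagonal.mem_antidiagonal.mp hp) j
    rw [Finsupp.add_apply, he j hj] at hadd
    omega

-- Collect the monomials of `f` according to some variable of `s` dividing them.
theorem mem_span_X_image_of_coeff_eq_zero {s : Finset σ} {f : MvPowerSeries σ R}
    (h : ∀ e : σ →₀ ℕ, (∀ j ∈ s, e j = 0) → coeff e f = 0) :
    f ∈ Ideal.span ((X : σ → MvPowerSeries σ R) '' s) := by
  classical
  obtain _ | _ := isEmpty_or_nonempty σ
  · obtain rfl : f = 0 := ext fun e => h e fun j => isEmptyElim j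
    exact zero_mem _
  have hvar : ∀ e, ∃ j, coeff e f ≠ 0 → j ∈ s ∧ e j ≠ 0 := fun e => by
    by_cases he : ∀ j ∈ s, e j = 0
    · exact ⟨Classical.arbitrary σ, fun hf => absurd (h e he) hf⟩
    · push Not at he
      exact he.imp fun j hj _ => hj
  choose v hv using hvar
  let part (j : σ) : MvPowerSeries σ R := fun e => if v e = j then coeff e f else 0
  have coeff_part (j e) : coeff e (part j) = if v e = j then coeff e f else 0 := rfl
  have hsum : f = ∑ j ∈ s, part j := by
    ext e
    rw [map_sum, Finset.sum_congr rfl fun j _ => coeff_part j e, Finset.sum_ite_eq]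
    split_ifs with hs
    · rfl
    · by_contra hf
      exact hs (hv e hf).1
  rw [hsum]
  refine Ideal.sum_mem _ fun j hj =>
    Ideal.mem_of_dvd _ (X_dvd_iff.mpr fun e hej => ?_) (Ideal.subset_span ⟨j, hj, rfl⟩)
  rw [coeff_part]
  split_ifs with hvj
  · by_contra hf
    exact (hv e hf).2 (hvj ▸ hej)
  · rfl

theorem mem_span_range_X_iff [Finite σ] {f : MvPowerSeries σ R} :
    f ∈ Ideal.span (Set.range (X : σ → MvPowerSeries σ R)) ↔ constantCoeff f = 0 := by
  have := Fintype.ofFinite σ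
  rw [← Set.image_univ, ← coeff_zero_eq_constantCoeff_apply]
  refine ⟨fun hf => coeff_eq_zero_of_mem_span_X_image hf fun _ _ => rfl, fun hf => ?_⟩
  rw [← Finset.coe_univ]
  refine mem_span_X_image_of_coeff_eq_zero fun e he => ?_
  obtain rfl : e = 0 := Finsupp.ext fun j => he j (Finset.mem_univ j)
  exact hf

theorem exists_eq_C_add_sum [Fintype σ] (f : MvPowerSeries σ R) :
    ∃ g : σ → MvPowerSeries σ R, f = C (constantCoeff f) + ∑ i, g i * X i := by
  have h : f - C (constantCoeff f) ∈ Ideal.span (Set.range (X : σ → MvPowerSeries σ R)) := by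
    simp [mem_span_range_X_iff]
  obtain ⟨g, hg⟩ := Ideal.mem_span_range_iff_exists_fun.mp h
  exact ⟨g, by rw [hg]; ring⟩

theorem isWeaklyRegular_map_X {l : List σ} (hl : l.Nodup) :
    RingTheory.Sequence.IsWeaklyRegular (MvPowerSeries σ R)
      (l.map (X : σ → MvPowerSeries σ R)) := by
  classical
  rw [RingTheory.Sequence.isWeaklyRegular_iff]
  intro i hi
  rw [List.length_map] at hi
  have hspan : Ideal.ofList ((l.map (X : σ → MvPowerSeries σ R)).take i) =
      Ideal.span (X '' ((l.take i).toFinset : Set σ)) := by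
    rw [← List.map_take, Ideal.ofList]
    congr 1
    ext r
    simp only [List.mem_map, Set.mem_ofPred_eq, Set.mem_image, Finset.mem_coe, List.mem_toFinset]
  have hnot : l[i] ∉ l.take i := fun hmem => by
    obtain ⟨j, hj, hji⟩ := List.getElem_of_mem hmem
    rw [List.getElem_take, hl.getElem_inj_iff] at hji
    simp only [List.length_take] at hj
    omega
  rw [isSMulRegular_quotient_iff_mem_of_smul_mem]
  intro f hf
  rw [hspan, smul_eq_mul, Ideal.mul_top] at hf ⊢
  refine mem_span_X_image_of_coeff_eq_zero fun e he => ?_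
  have hcoeff := coeff_eq_zero_of_mem_span_X_image (e := e + Finsupp.single l[i] 1) hf
    fun j hj => by
      have hne : l[i] ≠ j := by
        rintro rfl
        exact hnot (by simpa using hj)
      simp [he j hj, hne]
  rwa [List.getElem_map, smul_eq_mul, add_comm, X, coeff_add_monomial_mul, one_mul] at hcoeff

theorem ofList_map_toList_univ [Fintype σ] (f : σ → R) :
    Ideal.ofList ((Finset.univ : Finset σ).toList.map f) = Ideal.span (Set.range f) := by
  rw [Ideal.ofList]
  congr 1
  ext r
  simp

end VariableIdeals

section AlgHom

variable {σ τ k : Type*} [Field k]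

theorem mem_maximalIdeal_iff_constantCoeff_eq_zero {f : MvPowerSeries σ k} :
    f ∈ IsLocalRing.maximalIdeal (MvPowerSeries σ k) ↔ constantCoeff f = 0 := by
  rw [IsLocalRing.mem_maximalIdeal, mem_nonunits_iff, isUnit_iff_constantCoeff, isUnit_iff_ne_zero,
    not_not]

theorem maximalIdeal_eq_span_range_X [Finite σ] :
    IsLocalRing.maximalIdeal (MvPowerSeries σ k) = Ideal.span (Set.range X) := by
  ext f
  rw [mem_maximalIdeal_iff_constantCoeff_eq_zero, mem_span_range_X_iff]

theorem algHom_C (φ : MvPowerSeries τ k →ₐ[k] MvPowerSeries σ k) (c : k) : φ (C c) = C c :=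
  φ.commutes c

-- `f - C c` is a unit unless `c` is the constant coefficient of `f`.
@[simp]
theorem constantCoeff_algHom (φ : MvPowerSeries τ k →ₐ[k] MvPowerSeries σ k)
    (f : MvPowerSeries τ k) : constantCoeff (φ f) = constantCoeff f := by
  by_contra hne
  have hunit : IsUnit (f - C (constantCoeff (φ f))) := by
    rw [isUnit_iff_constantCoeff, map_sub, constantCoeff_C]
    exact (sub_ne_zero.mpr (Ne.symm hne)).isUnit
  have := isUnit_iff_constantCoeff.mp (hunit.map φ)
  simp [algHom_C] at this

theorem mem_of_forall_mem_sup_maximalIdeal_pow {R : Type*} [CommRing R] [IsLocalRing R]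
    [IsNoetherianRing R] {J : Ideal R} {x : R}
    (hx : ∀ N : ℕ, x ∈ J ⊔ IsLocalRing.maximalIdeal R ^ N) : x ∈ J := by
  have : IsHausdorff (IsLocalRing.maximalIdeal R) (R ⧸ J) :=
    .of_isLocalRing _ _ (Ideal.IsPrime.ne_top inferInstance)
  rw [← Ideal.Quotient.eq_zero_iff_mem]
  refine IsHausdorff.haus this _ fun N => SModEq.zero.mpr ?_
  obtain ⟨a, ha, b, hb, rfl⟩ := Submodule.mem_sup.mp (hx N)
  rw [map_add, Ideal.Quotient.eq_zero_iff_mem.mpr ha, zero_add, Ideal.smul_top_eq_map]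
  exact Ideal.mem_map_of_mem _ hb

theorem algHom_sub_mem [Finite σ] [Finite τ] {φ ψ : MvPowerSeries τ k →ₐ[k] MvPowerSeries σ k}
    {J : Ideal (MvPowerSeries σ k)} (h : ∀ i, φ (X i) - ψ (X i) ∈ J) (f : MvPowerSeries τ k) :
    φ f - ψ f ∈ J := by
  have := Fintype.ofFinite τ
  refine mem_of_forall_mem_sup_maximalIdeal_pow fun N => ?_
  induction N generalizing f with
  | zero => simp
  | succ N ih =>
    obtain ⟨g, hg⟩ := exists_eq_C_add_sum f
    have hsplit : φ f - ψ f = ∑ i, ((φ (g i) - ψ (g i)) * φ (X i) +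
        ψ (g i) * (φ (X i) - ψ (X i))) := by
      rw [hg]
      simp only [map_add, map_sum, map_mul, algHom_C, add_sub_add_left_eq_sub,
        ← Finset.sum_sub_distrib]
      exact Finset.sum_congr rfl fun i _ => by ring
    have hX (i) : φ (X i) ∈ IsLocalRing.maximalIdeal (MvPowerSeries σ k) :=
      mem_maximalIdeal_iff_constantCoeff_eq_zero.mpr (by simp)
    have hpow : (J ⊔ IsLocalRing.maximalIdeal _ ^ N) * IsLocalRing.maximalIdeal _ ≤
        J ⊔ IsLocalRing.maximalIdeal (MvPowerSeries σ k) ^ (N + 1) := by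
      rw [Ideal.sup_mul, pow_succ]
      exact sup_le_sup_right Ideal.mul_le_left _
    rw [hsplit]
    exact Ideal.sum_mem _ fun i _ => add_mem (hpow (Ideal.mul_mem_mul (ih _) (hX i)))
      (Ideal.mem_sup_left (Ideal.mul_mem_left _ _ (h i)))

theorem algHom_ext_of_X [Finite σ] [Finite τ]
    {φ ψ : MvPowerSeries τ k →ₐ[k] MvPowerSeries σ k} (h : ∀ i, φ (X i) = ψ (X i)) : φ = ψ :=
  AlgHom.ext fun f => sub_eq_zero.mp (algHom_sub_mem (J := ⊥) (fun i => by simp [h i]) f)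

theorem algHom_eq_C_constantCoeff [Finite τ]
    {φ : MvPowerSeries τ k →ₐ[k] MvPowerSeries σ k} (h : ∀ i, φ (X i) = 0)
    (f : MvPowerSeries τ k) : φ f = C (constantCoeff f) := by
  have := Fintype.ofFinite τ
  obtain ⟨g, hg⟩ := exists_eq_C_add_sum f
  conv_lhs => rw [hg]
  simp [h, algHom_C]

theorem coeff_single_mul_of_constantCoeff_eq_zero (t : σ) (f : MvPowerSeries σ k)
    {g : MvPowerSeries σ k} (hg : constantCoeff g = 0) :
    coeff (Finsupp.single t 1) (f * g) = constantCoeff f * coeff (Finsupp.single t 1) g := by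
  classical
  rw [coeff_mul, Finsupp.antidiagonal_single]
  simp [Finset.Nat.antidiagonal_succ, hg]

theorem coeff_single_algHom [Fintype τ] (φ : MvPowerSeries τ k →ₐ[k] MvPowerSeries σ k)
    (f : MvPowerSeries τ k) (t : σ) :
    coeff (Finsupp.single t 1) (φ f) =
      ∑ s, coeff (Finsupp.single s 1) f * coeff (Finsupp.single t 1) (φ (X s)) := by
  classical
  obtain ⟨g, hg⟩ := exists_eq_C_add_sum f
  have hpartial (s) : coeff (Finsupp.single s 1) f = constantCoeff (g s) := by
    conv_lhs => rw [hg]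
    have hterm (i) : coeff (Finsupp.single s 1) (g i * X i) =
        if s = i then constantCoeff (g i) else 0 := by
      rw [coeff_single_mul_of_constantCoeff_eq_zero _ _ (constantCoeff_X i), coeff_X]
      simp [Finsupp.single_left_inj]
    simp [hterm, coeff_C]
  conv_lhs => rw [hg]
  rw [map_add, algHom_C, map_add, coeff_C, if_neg (by simp), zero_add, map_sum, map_sum]
  refine Finset.sum_congr rfl fun i _ => ?_
  rw [map_mul, coeff_single_mul_of_constantCoeff_eq_zero _ _ (by simp), constantCoeff_algHom,
    hpartial]

end AlgHom

section FiniteMaps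

theorem maximalIdeal_le_radical_of_finite_quotient (k : Type*) {R : Type*} [Field k]
    [CommRing R] [IsLocalRing R] [Algebra k R] (I : Ideal R) [Module.Finite k (R ⧸ I)] :
    IsLocalRing.maximalIdeal R ≤ I.radical := by
  rw [Ideal.radical_eq_sInf]
  refine le_sInf ?_
  rintro P ⟨hIP, hP⟩
  have : Module.Finite k (R ⧸ P) :=
    .of_surjective (Ideal.Quotient.factorₐ k hIP).toLinearMap (Ideal.Quotient.factor_surjective hIP)
  have : IsArtinianRing (R ⧸ P) := .of_finite k _
  have hmax : P.IsMaximal := Ideal.Quotient.maximal_of_isField P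
    (IsArtinianRing.isField_of_isDomain _)
  exact (IsLocalRing.eq_maximalIdeal hmax).ge

variable {σ τ k : Type u} [Field k]

theorem hasDepthAtLeast_card [Fintype σ] :
    HasDepthAtLeast (MvPowerSeries σ k) (MvPowerSeries σ k) (Fintype.card σ) := by
  have hmem : ∀ r ∈ (Finset.univ : Finset σ).toList.map X,
      r ∈ IsLocalRing.maximalIdeal (MvPowerSeries σ k) := fun r hr => by
    obtain ⟨i, -, rfl⟩ := List.mem_map.mp hr
    exact mem_maximalIdeal_iff_constantCoeff_eq_zero.mpr (constantCoeff_X i)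
  exact ⟨Finset.univ.toList.map X, by simp, hmem, .of_isWeaklyRegular_of_mem_maximalIdeal _ hmem
    (isWeaklyRegular_map_X (Finset.nodup_toList _))⟩

section Algebra

variable [Algebra (MvPowerSeries τ k) (MvPowerSeries σ k)]

theorem map_span_range_X : (Ideal.span (Set.range X)).map
    (algebraMap (MvPowerSeries τ k) (MvPowerSeries σ k)) =
      Ideal.span (Set.range fun i => algebraMap (MvPowerSeries τ k) (MvPowerSeries σ k) (X i)) := by
  rw [Ideal.map_span, ← Set.range_comp, Function.comp_def]

variable [IsScalarTower k (MvPowerSeries τ k) (MvPowerSeries σ k)]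

theorem constantCoeff_algebraMap_X (i : τ) :
    constantCoeff (algebraMap (MvPowerSeries τ k) (MvPowerSeries σ k) (X i)) = 0 :=
  (constantCoeff_algHom (IsScalarTower.toAlgHom k _ _) (X i)).trans (constantCoeff_X i)

variable (hfin : Module.Finite k (MvPowerSeries σ k ⧸ Ideal.span (Set.range fun i =>
      algebraMap (MvPowerSeries τ k) (MvPowerSeries σ k) (X i))))

include hfin

theorem finite_of_finite_quotient [Finite σ] [Finite τ] :
    Module.Finite (MvPowerSeries τ k) (MvPowerSeries σ k) := by
  let A := MvPowerSeries τ k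
  let B := MvPowerSeries σ k
  let I : Ideal A := Ideal.span (Set.range X)
  have hle : I.map (algebraMap A B) ≤ IsLocalRing.maximalIdeal B := by
    rw [map_span_range_X, Ideal.span_le]
    rintro _ ⟨i, rfl⟩
    exact mem_maximalIdeal_iff_constantCoeff_eq_zero.mpr (constantCoeff_algebraMap_X i)
  have : IsHausdorff (I.map (algebraMap A B)) B :=
    .of_isLocalRing _ _ (ne_top_of_le_ne_top (Ideal.IsPrime.ne_top inferInstance) hle)
  have : IsHausdorff I B := IsHausdorff.map_algebraMap_iff.mp this
  have : Module.Finite k (B ⧸ I.map (algebraMap A B)) := by rwa [map_span_range_X]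
  have : Module.Finite A (B ⧸ I.map (algebraMap A B)) := .of_restrictScalars_finite k A _
  have : Module.Finite A (B ⧸ I • (⊤ : Submodule A B)) :=
    .equiv ((Submodule.Quotient.restrictScalarsEquiv A _).symm ≪≫ₗ
      Submodule.quotEquivOfEq _ _ (Ideal.smul_top_eq_map I).symm)
  exact finite_of_finite_quotient_smul_top I

theorem free_of_finite_quotient [Fintype σ] [Fintype τ]
    (hcard : Fintype.card τ = Fintype.card σ) :
    Module.Free (MvPowerSeries τ k) (MvPowerSeries σ k) := by
  have := finite_of_finite_quotient hfin
  refine free_of_isWeaklyRegular (rs := (Finset.univ : Finset τ).toList.map X)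
    (by rw [ofList_map_toList_univ, maximalIdeal_eq_span_range_X])
    (isWeaklyRegular_map_X (Finset.nodup_toList _)) ?_
  rw [← RingTheory.Sequence.isWeaklyRegular_map_algebraMap_iff (MvPowerSeries σ k), List.map_map]
  refine isWeaklyRegular_of_maximalIdeal_le_radical (fun y hy => ?_) ?_ ?_
  · obtain ⟨i, -, rfl⟩ := List.mem_map.mp hy
    exact mem_maximalIdeal_iff_constantCoeff_eq_zero.mpr (constantCoeff_algebraMap_X i)
  · simpa [hcard] using hasDepthAtLeast_card (σ := σ) (k := k)
  · rw [ofList_map_toList_univ]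
    have : Module.Finite k (MvPowerSeries σ k ⧸ Ideal.span (Set.range
      (algebraMap (MvPowerSeries τ k) (MvPowerSeries σ k) ∘ X))) := hfin
    exact (maximalIdeal_le_radical_of_finite_quotient k _).trans (Ideal.radical_mono le_sup_right)

end Algebra

theorem finrank_quotient_span_range_X [Finite σ] :
    Module.finrank k (MvPowerSeries σ k ⧸ Ideal.span (Set.range (X : σ → MvPowerSeries σ k))) =
      1 := by
  have hker : LinearMap.ker (coeff (R := k) (0 : σ →₀ ℕ)) =
      (Ideal.span (Set.range (X : σ → MvPowerSeries σ k))).restrictScalars k := by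
    ext f
    rw [LinearMap.mem_ker, Submodule.restrictScalars_mem, mem_span_range_X_iff,
      coeff_zero_eq_constantCoeff_apply]
  have hsurj : Function.Surjective (coeff (R := k) (0 : σ →₀ ℕ)) := fun c => ⟨C c, by simp⟩
  let e := (Submodule.Quotient.restrictScalarsEquiv k _).symm ≪≫ₗ
    Submodule.quotEquivOfEq _ _ hker.symm ≪≫ₗ LinearMap.quotKerEquivOfSurjective _ hsurj
  rw [e.finrank_eq, Module.finrank_self]

variable [Fintype σ] [Fintype τ] {φ : MvPowerSeries τ k →ₐ[k] MvPowerSeries σ k}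
  (hcard : Fintype.card τ = Fintype.card σ)
  (hfin : Module.Finite k (MvPowerSeries σ k ⧸ Ideal.span (Set.range fun i => φ (X i))))

include hcard hfin

theorem comap_map_of_finite_quotient (I : Ideal (MvPowerSeries τ k)) :
    (I.map φ).comap φ = I := by
  let := φ.toAlgebra
  have : IsScalarTower k (MvPowerSeries τ k) (MvPowerSeries σ k) :=
    .of_algebraMap_eq fun r => (φ.commutes r).symm
  have := free_of_finite_quotient hfin hcard
  exact Ideal.comap_map_eq_self_of_faithfullyFlat I

theorem finite_quotient_map_algHom_iff (I : Ideal (MvPowerSeries τ k)) :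
    Module.Finite k (MvPowerSeries σ k ⧸ I.map φ) ↔ Module.Finite k (MvPowerSeries τ k ⧸ I) := by
  let := φ.toAlgebra
  have : IsScalarTower k (MvPowerSeries τ k) (MvPowerSeries σ k) :=
    .of_algebraMap_eq fun r => (φ.commutes r).symm
  have := finite_of_finite_quotient hfin
  have := free_of_finite_quotient hfin hcard
  exact finite_quotient_map_iff I k

theorem finrank_quotient_map_algHom (I : Ideal (MvPowerSeries τ k)) :
    Module.finrank k (MvPowerSeries σ k ⧸ I.map φ) =
      Module.finrank k (MvPowerSeries σ k ⧸ Ideal.span (Set.range fun i => φ (X i))) *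
        Module.finrank k (MvPowerSeries τ k ⧸ I) := by
  let := φ.toAlgebra
  have : IsScalarTower k (MvPowerSeries τ k) (MvPowerSeries σ k) :=
    .of_algebraMap_eq fun r => (φ.commutes r).symm
  have := free_of_finite_quotient hfin hcard
  have hmult := finrank_quotient_map_eq_mul (B := MvPowerSeries σ k)
    (Ideal.span (Set.range (X : τ → MvPowerSeries τ k))) k
  rw [map_span_range_X, finrank_quotient_span_range_X, mul_one] at hmult
  exact (finrank_quotient_map_eq_mul I k).trans (congrArg (· * _) hmult.symm)

end FiniteMaps

section SumVariables

variable {α β : Type*}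

section CommSemiring

theorem finsupp_sumElim_inj {N : Type*} [Zero N] {a a' : α →₀ N} {b b' : β →₀ N} :
    Finsupp.sumElim a b = Finsupp.sumElim a' b' ↔ a = a' ∧ b = b' := by
  simp [Finsupp.ext_iff]

variable {R : Type*} [CommSemiring R]

theorem coeff_sumElim_mul (f g : MvPowerSeries (α ⊕ β) R) (a : α →₀ ℕ) (b : β →₀ ℕ)
    [DecidableEq α] [DecidableEq β] :
    coeff (Finsupp.sumElim a b) (f * g) =
      ∑ p ∈ Finset.HasAntidiagonal.antidiagonal a, ∑ q ∈ Finset.HasAntidiagonal.antidiagonal b,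
        coeff (Finsupp.sumElim p.1 q.1) f * coeff (Finsupp.sumElim p.2 q.2) g := by
  rw [coeff_mul, ← Finset.sum_product']
  let e : (α ⊕ β →₀ ℕ) ≃+ (α →₀ ℕ) × (β →₀ ℕ) := Finsupp.sumFinsuppAddEquivProdFinsupp
  refine Finset.sum_bij'
    (fun p _ => (((e p.1).1, (e p.2).1), ((e p.1).2, (e p.2).2)))
    (fun p _ => (e.symm (p.1.1, p.2.1), e.symm (p.1.2, p.2.2))) ?_ ?_ ?_ ?_ ?_
  · rintro ⟨p, q⟩ h
    have hadd : e p + e q = (a, b) := by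
      rw [← map_add, Finset.HasAntidiagonal.mem_antidiagonal.mp h]
      exact e.apply_symm_apply (a, b)
    simpa [Prod.ext_iff] using hadd
  · rintro ⟨p, q⟩ h
    simp only [Finset.mem_product, Finset.HasAntidiagonal.mem_antidiagonal] at h ⊢
    rw [← map_add, Prod.mk_add_mk, h.1, h.2]
    rfl
  · rintro ⟨p, q⟩ -
    exact Prod.ext (e.symm_apply_apply p) (e.symm_apply_apply q)
  · rintro ⟨p, q⟩ -
    simp
  · rintro ⟨p, q⟩ -
    exact congrArg₂ (coeff · f * coeff · g) (e.symm_apply_apply p).symm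
      (e.symm_apply_apply q).symm

/-- A power series in two groups of variables, seen as a power series in the first group whose
coefficients are power series in the second group; this is the map underlying `sumAlgEquiv`. -/
def sumToIterated (f : MvPowerSeries (α ⊕ β) R) : MvPowerSeries α (MvPowerSeries β R) :=
  fun a => (fun b => coeff (Finsupp.sumElim a b) f : MvPowerSeries β R)

theorem coeff_coeff_sumToIterated (f : MvPowerSeries (α ⊕ β) R) (a : α →₀ ℕ) (b : β →₀ ℕ) :
    coeff b (coeff a (sumToIterated f)) = coeff (Finsupp.sumElim a b) f :=
  rfl

/-- The identification of power series in two groups of variables with power series in the first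
group whose coefficients are power series in the second group; compare `MvPolynomial.sumAlgEquiv`.
-/
noncomputable def sumAlgEquiv :
    MvPowerSeries (α ⊕ β) R ≃ₐ[R] MvPowerSeries α (MvPowerSeries β R) where
  toFun := sumToIterated
  invFun g e := coeff (Finsupp.sumFinsuppEquivProdFinsupp e).2
    (coeff (Finsupp.sumFinsuppEquivProdFinsupp e).1 g)
  left_inv f := funext fun e =>
    congrArg (coeff · f) (Finsupp.sumFinsuppEquivProdFinsupp.symm_apply_apply e)
  right_inv g := by
    ext a b
    have he : Finsupp.sumFinsuppEquivProdFinsupp (Finsupp.sumElim a b) = (a, b) :=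
      Finsupp.sumFinsuppEquivProdFinsupp.apply_symm_apply (a, b)
    exact congrArg (fun p => coeff p.2 (coeff p.1 g)) he
  map_mul' f g := by
    classical
    ext a b
    rw [coeff_coeff_sumToIterated, coeff_sumElim_mul, coeff_mul, map_sum]
    simp only [coeff_mul, coeff_coeff_sumToIterated]
  map_add' f g := rfl
  commutes' c := by
    classical
    ext a b
    rw [coeff_coeff_sumToIterated]
    rw [MvPowerSeries.algebraMap_apply, MvPowerSeries.algebraMap_apply,
      MvPowerSeries.algebraMap_apply, Algebra.algebraMap_self,
      RingHom.id_apply, coeff_C, coeff_C, ← Finsupp.sumElim_zero_zero]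
    simp only [finsupp_sumElim_inj]
    by_cases ha : a = 0
    · simp [ha, coeff_C]
    · simp [ha]

theorem coeff_coeff_sumAlgEquiv (f : MvPowerSeries (α ⊕ β) R) (a : α →₀ ℕ) (b : β →₀ ℕ) :
    coeff b (coeff a (sumAlgEquiv f)) = coeff (Finsupp.sumElim a b) f :=
  rfl

@[simp]
theorem sumAlgEquiv_X_inl (i : α) :
    sumAlgEquiv (X (Sum.inl i) : MvPowerSeries (α ⊕ β) R) = X i := by
  classical
  ext a b
  rw [coeff_coeff_sumAlgEquiv, coeff_X, coeff_X, ← Finsupp.sumElim_single_zero]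
  simp only [finsupp_sumElim_inj]
  by_cases ha : a = Finsupp.single i 1
  · simp [ha, coeff_one]
  · simp [ha]

@[simp]
theorem sumAlgEquiv_X_inr (j : β) :
    sumAlgEquiv (X (Sum.inr j) : MvPowerSeries (α ⊕ β) R) = C (X j) := by
  classical
  ext a b
  rw [coeff_coeff_sumAlgEquiv, coeff_X, coeff_C, ← Finsupp.sumElim_zero_single]
  simp only [finsupp_sumElim_inj]
  by_cases ha : a = 0
  · simp [ha, coeff_X]
  · simp [ha]

end CommSemiring

theorem mem_map_C_iff {A : Type*} [CommRing A] {K : Ideal A} (hK : K.FG)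
    {f : MvPowerSeries α A} : f ∈ K.map C ↔ ∀ a, coeff a f ∈ K := by
  constructor
  · intro hf a
    have hle : K.map C ≤ RingHom.ker (map (σ := α) (Ideal.Quotient.mk K)) := by
      rw [Ideal.map_le_iff_le_comap]
      intro r hr
      rw [Ideal.mem_comap, RingHom.mem_ker, map_C, Ideal.Quotient.eq_zero_iff_mem.mpr hr, map_zero]
    have hzero := congrArg (coeff a) (RingHom.mem_ker.mp (hle hf))
    rwa [coeff_map, map_zero, Ideal.Quotient.eq_zero_iff_mem] at hzero
  · intro h
    obtain ⟨m, v, rfl⟩ := Submodule.fg_iff_exists_fin_generating_family.mp hK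
    choose c hc using fun a => Ideal.mem_span_range_iff_exists_fun.mp (h a)
    let g (i : Fin m) : MvPowerSeries α A := fun a => c a i
    have hf : f = ∑ i, g i * C (v i) := by
      ext a
      rw [← hc a, map_sum]
      exact Finset.sum_congr rfl fun i _ => (coeff_mul_C a (g i) (v i)).symm
    rw [hf]
    exact Ideal.sum_mem _ fun i _ =>
      Ideal.mul_mem_left _ _ (Ideal.mem_map_of_mem _ (Ideal.subset_span ⟨i, rfl⟩))

@[simp]
theorem killCompl_inl_X_inl {R : Type*} [CommRing R] (i : α) :
    killCompl (Function.Embedding.inl : α ↪ α ⊕ β) (X (Sum.inl i)) = (X i : MvPowerSeries α R) :=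
  killCompl_X (e := Function.Embedding.inl) i

@[simp]
theorem killCompl_inl_X_inr {R : Type*} [CommRing R] (j : β) :
    killCompl (Function.Embedding.inl : α ↪ α ⊕ β) (X (Sum.inr j)) = (0 : MvPowerSeries α R) :=
  killCompl_X_eq_zero (by simp)

variable {k : Type*} [Field k]

theorem killCompl_inl_rename_inr [Finite β] (f : MvPowerSeries β k) :
    killCompl (Function.Embedding.inl : α ↪ α ⊕ β) (rename Sum.inr f) = C (constantCoeff f) :=
  algHom_eq_C_constantCoeff (φ := (killCompl _).comp (rename Sum.inr))
    (fun i => by rw [AlgHom.comp_apply, rename_X, killCompl_X_eq_zero (by simp)]) f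

theorem sub_rename_killCompl_inl_mem [Finite α] [Finite β] (f : MvPowerSeries (α ⊕ β) k) :
    f - rename Sum.inl (killCompl Function.Embedding.inl f) ∈
      Ideal.span (Set.range fun j : β => (X (Sum.inr j) : MvPowerSeries (α ⊕ β) k)) := by
  classical
  have := Fintype.ofFinite β
  have hrange : (Set.range fun j : β => (X (Sum.inr j) : MvPowerSeries (α ⊕ β) k)) =
      X '' ((Finset.univ.image Sum.inr : Finset (α ⊕ β)) : Set (α ⊕ β)) := by
    rw [Finset.coe_image, Finset.coe_univ, Set.image_univ, ← Set.range_comp, Function.comp_def]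
  rw [hrange]
  refine mem_span_X_image_of_coeff_eq_zero fun e he => ?_
  have hemb : e = Finsupp.embDomain Function.Embedding.inl
      (e.comapDomain Sum.inl Sum.inl_injective.injOn) := by
    refine Finsupp.ext ?_
    rintro (i | j)
    · exact (Finsupp.embDomain_apply_self Function.Embedding.inl (e.comapDomain _ _) i).symm
    · rw [he (Sum.inr j) (by simp), Finsupp.embDomain_of_notMem_range _ _ _ (by simp)]
  rw [map_sub, hemb]
  exact sub_eq_zero.mpr ((coeff_embDomain_rename Function.Embedding.inl _ _).trans
    (coeff_killCompl _ _)).symm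

theorem sumAlgEquiv_rename_inr [Finite α] [Finite β] (f : MvPowerSeries β k) :
    sumAlgEquiv (rename (Sum.inr : β → α ⊕ β) f) = C f := by
  have h : rename (Sum.inr : β → α ⊕ β) = sumAlgEquiv.symm.toAlgHom.comp
      (IsScalarTower.toAlgHom k (MvPowerSeries β k) (MvPowerSeries α (MvPowerSeries β k))) := by
    refine algHom_ext_of_X fun j => ?_
    rw [rename_X]
    exact (sumAlgEquiv.symm_apply_eq.mpr (sumAlgEquiv_X_inr j).symm).symm
  rw [h]
  exact sumAlgEquiv.apply_symm_apply (C f)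

theorem mem_map_rename_inr_iff [Finite α] [Finite β] {K : Ideal (MvPowerSeries β k)}
    {f : MvPowerSeries (α ⊕ β) k} :
    f ∈ K.map (rename (Sum.inr : β → α ⊕ β)) ↔ ∀ a, coeff a (sumAlgEquiv f) ∈ K := by
  rw [← mem_map_C_iff (IsNoetherian.noetherian K)]
  constructor <;> intro hf
  · have hle : K.map (rename (Sum.inr : β → α ⊕ β)) ≤ (K.map C).comap sumAlgEquiv.toAlgHom := by
      rw [Ideal.map_le_iff_le_comap]
      intro g hg
      rw [Ideal.mem_comap, Ideal.mem_comap]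
      exact (sumAlgEquiv_rename_inr (α := α) g).symm ▸ Ideal.mem_map_of_mem C hg
    exact hle hf
  · have hle : K.map C ≤ (K.map (rename (Sum.inr : β → α ⊕ β))).comap
        sumAlgEquiv.symm.toAlgHom := by
      rw [Ideal.map_le_iff_le_comap]
      intro g hg
      rw [Ideal.mem_comap, Ideal.mem_comap]
      have hsymm : sumAlgEquiv.symm (C g) = rename (Sum.inr : β → α ⊕ β) g :=
        sumAlgEquiv.symm_apply_eq.mpr (sumAlgEquiv_rename_inr g).symm
      exact hsymm ▸ Ideal.mem_map_of_mem _ hg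
    exact sumAlgEquiv.symm_apply_apply f ▸ hle hf

section SumMap

variable {α' β' : Type*} [Finite α] [Finite β] [Finite α'] [Finite β']

/-- The homomorphism of power series rings in two groups of variables that acts by `φ` on the first
group and by `ψ` on the second. -/
noncomputable def sumMap (φ : MvPowerSeries α' k →ₐ[k] MvPowerSeries α k)
    (ψ : MvPowerSeries β' k →ₐ[k] MvPowerSeries β k) :
    MvPowerSeries (α' ⊕ β') k →ₐ[k] MvPowerSeries (α ⊕ β) k :=
  substAlgHom (hasSubst_of_constantCoeff_zero
    (a := Sum.elim (fun i => rename Sum.inl (φ (X i))) fun j => rename Sum.inr (ψ (X j)))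
    (by rintro (i | j) <;> simp))

variable (φ : MvPowerSeries α' k →ₐ[k] MvPowerSeries α k)
  (ψ : MvPowerSeries β' k →ₐ[k] MvPowerSeries β k)

@[simp]
theorem sumMap_X_inl (i : α') : sumMap φ ψ (X (Sum.inl i)) = rename Sum.inl (φ (X i)) :=
  substAlgHom_X _ _

@[simp]
theorem sumMap_X_inr (j : β') : sumMap φ ψ (X (Sum.inr j)) = rename Sum.inr (ψ (X j)) :=
  substAlgHom_X _ _

@[simp]
theorem sumMap_rename_inl (f : MvPowerSeries α' k) :
    sumMap φ ψ (rename Sum.inl f) = rename Sum.inl (φ f) := by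
  have h : (sumMap φ ψ).comp (rename Sum.inl) = (rename Sum.inl).comp φ :=
    algHom_ext_of_X fun i => by simp
  exact AlgHom.congr_fun h f

@[simp]
theorem sumMap_rename_inr (f : MvPowerSeries β' k) :
    sumMap φ ψ (rename Sum.inr f) = rename Sum.inr (ψ f) := by
  have h : (sumMap φ ψ).comp (rename Sum.inr) = (rename Sum.inr).comp ψ :=
    algHom_ext_of_X fun i => by simp
  exact AlgHom.congr_fun h f

theorem sumMap_comp_sumMap {α'' β'' : Type*} [Finite α''] [Finite β'']
    (φ' : MvPowerSeries α'' k →ₐ[k] MvPowerSeries α' k)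
    (ψ' : MvPowerSeries β'' k →ₐ[k] MvPowerSeries β' k) :
    (sumMap φ ψ).comp (sumMap φ' ψ') = sumMap (φ.comp φ') (ψ.comp ψ') :=
  algHom_ext_of_X <| by rintro (i | j) <;> simp

theorem killCompl_inl_sumMap (f : MvPowerSeries (α' ⊕ β') k) :
    killCompl Function.Embedding.inl (sumMap φ ψ f) = φ (killCompl Function.Embedding.inl f) := by
  have h : (killCompl Function.Embedding.inl).comp (sumMap φ ψ) =
      φ.comp (killCompl Function.Embedding.inl) := by
    refine algHom_ext_of_X ?_
    rintro (i | j) <;> simp only [AlgHom.comp_apply, sumMap_X_inl, sumMap_X_inr]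
    · rw [killCompl_inl_X_inl]
      exact killCompl_rename_app (e := Function.Embedding.inl) (φ (X i))
    · rw [killCompl_inl_rename_inr, killCompl_inl_X_inr, map_zero, constantCoeff_algHom,
        constantCoeff_X, map_zero]
  exact AlgHom.congr_fun h f

theorem sumAlgEquiv_sumMap_id (f : MvPowerSeries (α ⊕ β') k) :
    sumAlgEquiv (sumMap (AlgHom.id k (MvPowerSeries α k)) ψ f) = map ψ (sumAlgEquiv f) := by
  have h : sumMap (AlgHom.id k (MvPowerSeries α k)) ψ =
      sumAlgEquiv.symm.toAlgHom.comp ((mapAlgHom ψ).comp sumAlgEquiv.toAlgHom) := by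
    refine algHom_ext_of_X ?_
    rintro (i | j) <;> refine (sumAlgEquiv.symm_apply_eq.mpr ?_).symm
    · simp [mapAlgHom_apply]
    · simp [mapAlgHom_apply, sumAlgEquiv_rename_inr]
  rw [h]
  exact sumAlgEquiv.apply_symm_apply _

end SumMap

section Descent

variable {α α' β k : Type u} [Field k]
  {φ : MvPowerSeries α' k →ₐ[k] MvPowerSeries α k}

theorem finite_quotient_sumMap_id [Finite α] [Finite α'] [Finite β]
    (hfin : Module.Finite k (MvPowerSeries α k ⧸ Ideal.span (Set.range fun i => φ (X i)))) :
    Module.Finite k (MvPowerSeries (α ⊕ β) k ⧸ Ideal.span (Set.range fun i =>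
      sumMap φ (AlgHom.id k (MvPowerSeries β k)) (X i))) := by
  let J : Ideal (MvPowerSeries (α ⊕ β) k) := Ideal.span (Set.range fun i =>
    sumMap φ (AlgHom.id k (MvPowerSeries β k)) (X i))
  have hI : Ideal.span (Set.range fun i => φ (X i)) ≤ J.comap (rename (R := k) Sum.inl) := by
    rw [Ideal.span_le]
    rintro _ ⟨i, rfl⟩
    exact Ideal.subset_span ⟨Sum.inl i, by simp⟩
  have hinr :
      Ideal.span (Set.range fun j : β => (X (Sum.inr j) : MvPowerSeries (α ⊕ β) k)) ≤ J := by
    rw [Ideal.span_le]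
    rintro _ ⟨j, rfl⟩
    exact Ideal.subset_span ⟨Sum.inr j, by simp⟩
  refine Module.Finite.of_surjective (Ideal.quotientMapₐ J (rename Sum.inl) hI).toLinearMap ?_
  rintro ⟨g⟩
  exact ⟨Ideal.Quotient.mk _ (killCompl Function.Embedding.inl g),
    (Ideal.Quotient.eq.mpr (hinr (sub_rename_killCompl_inl_mem g))).symm⟩

theorem mem_map_rename_inr_of_sumMap_id_mem [Fintype α] [Fintype α'] [Finite β]
    (hcard : Fintype.card α' = Fintype.card α)
    (hfin : Module.Finite k (MvPowerSeries α k ⧸ Ideal.span (Set.range fun i => φ (X i))))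
    {K : Ideal (MvPowerSeries β k)} {g : MvPowerSeries (α' ⊕ β) k}
    (hg : sumMap φ (AlgHom.id k (MvPowerSeries β k)) g ∈ K.map (rename Sum.inr)) :
    g ∈ K.map (rename Sum.inr) := by
  have := Fintype.ofFinite β
  have hmap : (K.map (rename (R := k) (Sum.inr : β → α' ⊕ β))).map
      (sumMap φ (AlgHom.id k (MvPowerSeries β k))) = K.map (rename Sum.inr) := by
    rw [Ideal.map_mapₐ]
    congr 1
    exact AlgHom.ext fun f => by simp
  rw [← hmap] at hg
  exact (comap_map_of_finite_quotient (by simp [hcard]) (finite_quotient_sumMap_id hfin) _).le hg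

end Descent

end SumVariables

section Substitution

variable {σ τ k : Type*} [Field k] [Finite τ]

theorem algHom_apply_eq_subst [Finite σ] (φ : MvPowerSeries τ k →ₐ[k] MvPowerSeries σ k)
    (f : MvPowerSeries τ k) : φ f = subst (fun i => φ (X i)) f := by
  have ha : HasSubst fun i => φ (X i) := hasSubst_of_constantCoeff_zero fun i => by simp
  have h : φ = substAlgHom ha := algHom_ext_of_X fun i => (substAlgHom_X ha i).symm
  exact (AlgHom.congr_fun h f).trans (substAlgHom_apply ha f)

theorem algHom_rename_killCompl (e : σ ↪ τ) {υ : Type*} [Finite υ]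
    {φ : MvPowerSeries τ k →ₐ[k] MvPowerSeries υ k} (h : ∀ j ∉ Set.range e, φ (X j) = 0)
    (f : MvPowerSeries τ k) : φ (rename e (killCompl e f)) = φ f := by
  have hext : (φ.comp (rename e)).comp (killCompl e) = φ := by
    refine algHom_ext_of_X fun j => ?_
    by_cases hj : j ∈ Set.range e
    · obtain ⟨i, rfl⟩ := hj
      simp [killCompl_X, rename_X]
    · simp [killCompl_X_eq_zero hj, h j hj]
  exact AlgHom.congr_fun hext f

end Substitution

section LinearParts

theorem sum_coeff_single_mul_of_eq_sum {α β k : Type*} [Fintype α] [Fintype β] [Field k]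
    {f : MvPowerSeries (α ⊕ β) k} {b : β → MvPowerSeries (α ⊕ β) k}
    (h : f = ∑ l, b l * X (Sum.inr l)) (v : α ⊕ β → k) :
    ∑ t, coeff (Finsupp.single t 1) f * v t = ∑ l, constantCoeff (b l) * v (Sum.inr l) := by
  classical
  subst h
  simp only [map_sum, coeff_single_mul_of_constantCoeff_eq_zero _ _ (constantCoeff_X _), coeff_X,
    Finset.sum_mul]
  rw [Finset.sum_comm]
  refine Finset.sum_congr rfl fun l _ => ?_
  rw [Finset.sum_eq_single (Sum.inr l)]
  · simp
  · intro t _ ht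
    simp [Finsupp.single_left_inj, ht]
  · simp

theorem isUnit_map_constantCoeff_iff {σ ι k : Type*} [Field k] [Fintype ι] [DecidableEq ι]
    {a : Matrix ι ι (MvPowerSeries σ k)} : IsUnit (a.map constantCoeff) ↔ IsUnit a := by
  rw [Matrix.isUnit_iff_isUnit_det, Matrix.isUnit_iff_isUnit_det, isUnit_iff_constantCoeff,
    RingHom.map_det, RingHom.mapMatrix_apply]

end LinearParts

section IdealSpan

theorem span_range_le_of_eq_mul {R ι κ : Type*} [CommRing R] [Fintype κ] {a : Matrix ι κ R}
    {u : ι → R} {v : κ → R} (h : ∀ i, u i = ∑ k, a i k * v k) :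
    Ideal.span (Set.range u) ≤ Ideal.span (Set.range v) := by
  rw [Ideal.span_le]
  rintro _ ⟨i, rfl⟩
  rw [h]
  exact Ideal.sum_mem _ fun k _ => Ideal.mul_mem_left _ _ (Ideal.subset_span ⟨k, rfl⟩)

theorem span_range_eq_of_isUnit {R ι : Type*} [CommRing R] [Fintype ι] [DecidableEq ι]
    {a : Matrix ι ι R} (ha : IsUnit a) {u v : ι → R} (h : ∀ i, u i = ∑ k, a i k * v k) :
    Ideal.span (Set.range u) = Ideal.span (Set.range v) := by
  refine le_antisymm (span_range_le_of_eq_mul h) ?_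
  obtain ⟨b, hb⟩ := ha.exists_left_inv
  have hu : u = a.mulVec v := funext h
  refine span_range_le_of_eq_mul (a := b) fun i => ?_
  change v i = b.mulVec u i
  rw [hu, Matrix.mulVec_mulVec, hb, Matrix.one_mulVec]

end IdealSpan

section Conjugation

variable {σ ι : Type}

theorem conjSeries_conjSeries (f : MvPowerSeries σ ℂ) : conjSeries (conjSeries f) = f := by
  ext e
  simp [conjSeries]

/-- The ring automorphism `f ↦ f̄` of the power series ring; it is conjugate linear over `ℂ`. -/
noncomputable def conjEquiv (σ : Type) : MvPowerSeries σ ℂ ≃+* MvPowerSeries σ ℂ :=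
  RingEquiv.ofRingHom (map (starRingEnd ℂ)) (map (starRingEnd ℂ))
    (RingHom.ext conjSeries_conjSeries) (RingHom.ext conjSeries_conjSeries)

/-- Conjugation of series, as an isomorphism between the quotients by the ideals generated by
`f_i` and by `f̄_i`. -/
noncomputable def conjQuotientEquiv (f : ι → MvPowerSeries σ ℂ) :
    (MvPowerSeries σ ℂ ⧸ Ideal.span (Set.range f)) ≃+*
      (MvPowerSeries σ ℂ ⧸ Ideal.span (Set.range fun i => conjSeries (f i))) :=
  Ideal.quotientEquiv _ _ (conjEquiv σ) <| by
    rw [Ideal.map_span, ← Set.range_comp]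
    rfl

theorem algebraMap_comp_starRingAut (f : ι → MvPowerSeries σ ℂ) :
    (algebraMap ℂ (MvPowerSeries σ ℂ ⧸ Ideal.span (Set.range fun i => conjSeries (f i)))).comp
      (starRingAut (R := ℂ) : ℂ →+* ℂ) =
    (conjQuotientEquiv f : _ →+* _).comp
      (algebraMap ℂ (MvPowerSeries σ ℂ ⧸ Ideal.span (Set.range f))) :=
  RingHom.ext fun c => congrArg (Ideal.Quotient.mk _) (map_C (starRingEnd ℂ) c).symm

theorem finite_quotient_span_conjSeries_iff {f : ι → MvPowerSeries σ ℂ} :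
    Module.Finite ℂ (MvPowerSeries σ ℂ ⧸ Ideal.span (Set.range fun i => conjSeries (f i))) ↔
      Module.Finite ℂ (MvPowerSeries σ ℂ ⧸ Ideal.span (Set.range f)) := by
  have hfin (g : ι → MvPowerSeries σ ℂ)
      (_ : Module.Finite ℂ (MvPowerSeries σ ℂ ⧸ Ideal.span (Set.range g))) :
      Module.Finite ℂ
        (MvPowerSeries σ ℂ ⧸ Ideal.span (Set.range fun i => conjSeries (g i))) :=
    Module.Finite.of_equiv_equiv _ (conjQuotientEquiv g) (algebraMap_comp_starRingAut g)
  have hconj : (fun i => conjSeries (conjSeries (f i))) = f :=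
    funext fun i => conjSeries_conjSeries (f i)
  exact ⟨fun h => hconj ▸ hfin _ h, hfin f⟩

theorem finrank_quotient_span_conjSeries (f : ι → MvPowerSeries σ ℂ) :
    Module.finrank ℂ (MvPowerSeries σ ℂ ⧸ Ideal.span (Set.range fun i => conjSeries (f i))) =
      Module.finrank ℂ (MvPowerSeries σ ℂ ⧸ Ideal.span (Set.range f)) :=
  (Algebra.finrank_eq_of_equiv_equiv (starRingAut (R := ℂ)) (conjQuotientEquiv f)
    (algebraMap_comp_starRingAut f)).symm

end Conjugation

namespace FormalMap

variable {σ τ υ : Type} [Finite τ]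

/-- The pullback `f ↦ f ∘ H` of formal power series along a formal mapping `H`. -/
noncomputable def pullback (H : FormalMap σ τ) : MvPowerSeries τ ℂ →ₐ[ℂ] MvPowerSeries σ ℂ :=
  substAlgHom H.hasSubst

@[simp]
theorem pullback_X (H : FormalMap σ τ) (i : τ) : H.pullback (X i) = H.toSeries i :=
  substAlgHom_X H.hasSubst i

theorem comp_toSeries (g : FormalMap τ υ) (f : FormalMap σ τ) (i : υ) :
    (g.comp f).toSeries i = f.pullback (g.toSeries i) :=
  (substAlgHom_apply f.hasSubst _).symm

theorem pullback_comp [Finite σ] [Finite υ] (g : FormalMap τ υ) (f : FormalMap σ τ) :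
    (g.comp f).pullback = f.pullback.comp g.pullback :=
  algHom_ext_of_X fun i => by simp [comp_toSeries]

@[simp]
theorem pullback_id [Finite σ] : (FormalMap.id σ).pullback = AlgHom.id ℂ _ :=
  algHom_ext_of_X fun i => by simp [FormalMap.id]

/-- The mapping `H̄` whose components have the conjugate coefficients. -/
noncomputable def conj (H : FormalMap σ τ) : FormalMap σ τ where
  toSeries i := conjSeries (H.toSeries i)
  constantCoeff_eq_zero i := by
    rw [conjSeries, constantCoeff_map, H.constantCoeff_eq_zero, map_zero]

theorem conjSeries_pullback (H : FormalMap σ τ) (f : MvPowerSeries τ ℂ) :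
    conjSeries (H.pullback f) = H.conj.pullback (conjSeries f) := by
  simp only [pullback, substAlgHom_apply]
  exact map_subst H.hasSubst f

theorem conj_comp (g : FormalMap τ υ) (f : FormalMap σ τ) :
    (g.comp f).conj = g.conj.comp f.conj :=
  FormalMap.ext <| funext fun i => by
    change conjSeries ((g.comp f).toSeries i) = (g.conj.comp f.conj).toSeries i
    rw [comp_toSeries, comp_toSeries, conjSeries_pullback]
    rfl

theorem conj_id : (FormalMap.id σ).conj = FormalMap.id σ :=
  FormalMap.ext <| funext fun i => MvPowerSeries.map_X _ i

/-- The pullback of formal power series in `(Z, ζ)` along the complexification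
`(Z, ζ) ↦ (H(Z), H̄(ζ))` of `H`. -/
noncomputable def doublePullback [Finite σ] (H : FormalMap σ τ) :
    MvPowerSeries (τ ⊕ τ) ℂ →ₐ[ℂ] MvPowerSeries (σ ⊕ σ) ℂ :=
  sumMap H.pullback H.conj.pullback

theorem subst_double [Finite σ] (H : FormalMap σ τ) (f : MvPowerSeries (τ ⊕ τ) ℂ) :
    subst H.double f = H.doublePullback f := by
  rw [algHom_apply_eq_subst]
  congr 1
  funext i
  rcases i with i | i
  · simp [doublePullback, double, rename_eq_subst, Function.comp_def]
  · simp [doublePullback, double, rename_eq_subst, Function.comp_def, conj]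

theorem doublePullback_comp [Finite σ] [Finite υ] (g : FormalMap τ υ) (f : FormalMap σ τ) :
    (g.comp f).doublePullback = f.doublePullback.comp g.doublePullback := by
  simp only [doublePullback, sumMap_comp_sumMap, pullback_comp, conj_comp]

theorem doublePullback_id [Finite σ] : (FormalMap.id σ).doublePullback = AlgHom.id ℂ _ := by
  refine algHom_ext_of_X ?_
  rintro (i | i) <;> simp [doublePullback, conj_id]

section Differential

variable {σ τ υ : Type} [Fintype σ]

theorem differential_apply (H : FormalMap σ τ) (v : σ → ℂ) (i : τ) :
    H.differential v i = ∑ s, coeff (Finsupp.single s 1) (H.toSeries i) * v s :=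
  rfl

theorem differential_comp [Fintype τ] (g : FormalMap τ υ) (f : FormalMap σ τ) :
    (g.comp f).differential = g.differential ∘ₗ f.differential := by
  simp only [differential]
  rw [← Matrix.mulVecLin_mul]
  congr 1
  ext i s
  simp [Matrix.mul_apply, comp_toSeries, coeff_single_algHom]

theorem differential_id : (FormalMap.id σ).differential = LinearMap.id := by
  classical
  rw [← Matrix.mulVecLin_one, differential]
  congr 1
  ext i s
  simp [FormalMap.id, coeff_X, Matrix.one_apply, Finsupp.single_left_inj, eq_comm]

end Differential

end FormalMap

namespace NormalCoordinates

variable {n d : ℕ} {M M' : FormalGenericSubmanifold (n + d) d}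

section DefiningFunctions

/-- The inclusion of the series in `(z, χ, τ)` into the series in `(z, w, χ, τ)`. -/
noncomputable def toAmbient :
    MvPowerSeries (Fin n ⊕ (Fin n ⊕ Fin d)) ℂ →ₐ[ℂ]
      MvPowerSeries ((Fin n ⊕ Fin d) ⊕ (Fin n ⊕ Fin d)) ℂ :=
  rename (Sum.map Sum.inl _root_.id)

/-- The defining functions `w_k - Q_k(z, χ, τ)` of `M` in the normal coordinates `x`. -/
noncomputable def graph (x : NormalCoordinates M) (k : Fin d) :
    MvPowerSeries ((Fin n ⊕ Fin d) ⊕ (Fin n ⊕ Fin d)) ℂ :=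
  X (Sum.inl (Sum.inr k)) - toAmbient (x.Q k)

theorem exists_doublePullback_rho_eq (x : NormalCoordinates M) :
    ∃ a : Matrix (Fin d) (Fin d) (MvPowerSeries ((Fin n ⊕ Fin d) ⊕ (Fin n ⊕ Fin d)) ℂ),
      IsUnit a ∧ ∀ j, x.coord.doublePullback (M.rho j) = ∑ k, a j k * x.graph k := by
  obtain ⟨a, ha, h⟩ := x.defining
  refine ⟨a, ha, fun j => ?_⟩
  rw [← FormalMap.subst_double, h]
  refine Finset.sum_congr rfl fun k _ => ?_
  rw [graph, toAmbient, algHom_apply_eq_subst]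
  congr! 3
  funext i
  rcases i with i | i <;> simp [rename_X]

theorem span_doublePullback_rho (x : NormalCoordinates M) :
    Ideal.span (Set.range fun j => x.coord.doublePullback (M.rho j)) =
      Ideal.span (Set.range x.graph) :=
  let ⟨_, ha, h⟩ := x.exists_doublePullback_rho_eq
  span_range_eq_of_isUnit ha h

theorem doublePullback_express_coord (x : NormalCoordinates M) (x' : NormalCoordinates M')
    (H : FormalMap (Fin (n + d)) (Fin (n + d)))
    (f : MvPowerSeries (Fin (n + d) ⊕ Fin (n + d)) ℂ) :
    (express x x' H).doublePullback (x'.coord.doublePullback f) =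
      x.coord.doublePullback (H.doublePullback f) := by
  have hinv : x'.inv.doublePullback (x'.coord.doublePullback f) = f := by
    rw [← AlgHom.comp_apply, ← FormalMap.doublePullback_comp, x'.coord_comp_inv,
      FormalMap.doublePullback_id, AlgHom.id_apply]
  simp only [express, FormalMap.doublePullback_comp, AlgHom.comp_apply, hinv]

theorem doublePullback_express_graph_mem (x : NormalCoordinates M) (x' : NormalCoordinates M')
    {H : FormalMap (Fin (n + d)) (Fin (n + d))} (hH : H.MapsInto M M') (k : Fin d) :
    (express x x' H).doublePullback (x'.graph k) ∈ Ideal.span (Set.range x.graph) := by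
  have hle : Ideal.span (Set.range x'.graph) ≤
      (Ideal.span (Set.range x.graph)).comap (express x x' H).doublePullback := by
    rw [← span_doublePullback_rho, ← span_doublePullback_rho, Ideal.span_le]
    rintro _ ⟨j, rfl⟩
    obtain ⟨c, hc⟩ := hH
    rw [SetLike.mem_coe, Ideal.mem_comap, doublePullback_express_coord,
      ← H.subst_double, hc, map_sum]
    refine Ideal.sum_mem _ fun i _ => ?_
    rw [map_mul]
    exact Ideal.mul_mem_left _ _ (Ideal.subset_span ⟨i, rfl⟩)
  exact hle (Ideal.subset_span ⟨k, rfl⟩)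

end DefiningFunctions

section SegreVarieties

theorem killCompl_chi_Q (x : NormalCoordinates M) (k : Fin d) :
    killCompl (Function.Embedding.sumMap (.refl _) .inr) (x.Q k) = X (Sum.inr k) := by
  rw [← x.normal_right k, algHom_apply_eq_subst]
  congr 1
  funext i
  rcases i with i | i | i
  · exact killCompl_X (e := Function.Embedding.sumMap (.refl _) .inr) (Sum.inl i)
  · exact killCompl_X_eq_zero (by simp)
  · exact killCompl_X (e := Function.Embedding.sumMap (.refl _) .inr) (Sum.inr i)

theorem algHom_Q_eq_zero (x : NormalCoordinates M) {σ : Type} [Finite σ]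
    {φ : MvPowerSeries (Fin n ⊕ (Fin n ⊕ Fin d)) ℂ →ₐ[ℂ] MvPowerSeries σ ℂ}
    (h : ∀ i, φ (X (Sum.inr i)) = 0) (k : Fin d) : φ (x.Q k) = 0 := by
  have hkill : ∀ j ∉ Set.range (Function.Embedding.sumMap (.refl (Fin n)) .inr),
      φ (X j) = 0 := by
    rintro (i | i) hi
    · exact absurd ⟨Sum.inl i, rfl⟩ hi
    · exact h i
  rw [← algHom_rename_killCompl _ hkill, killCompl_chi_Q, rename_X]
  exact h (Sum.inr k)

/-- The series `Q_k(z, χ, 0)`, whose graph is the Segre variety of the point `(χ̄, 0)`. -/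
noncomputable def segreQ (x : NormalCoordinates M) (k : Fin d) :
    MvPowerSeries (Fin n ⊕ Fin n) ℂ :=
  killCompl (Function.Embedding.sumMap (.refl _) .inl) (x.Q k)

theorem coeff_sumAlgEquiv_segreQ (x : NormalCoordinates M) (k : Fin d) (a : Fin n →₀ ℕ) :
    coeff a (sumAlgEquiv (x.segreQ k)) = x.qCoeff k a := by
  ext b
  rw [coeff_coeff_sumAlgEquiv, segreQ, coeff_killCompl]
  refine congrArg (coeff · (x.Q k)) (Finsupp.ext ?_)
  rintro (i | i | i)
  · exact Finsupp.embDomain_apply_self (Function.Embedding.sumMap (.refl _) .inl) _ (Sum.inl i)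
  · exact Finsupp.embDomain_apply_self (Function.Embedding.sumMap (.refl _) .inl) _ (Sum.inr i)
  · exact Finsupp.embDomain_of_notMem_range _ _ _ (by simp)

theorem essentialIdeal_le_iff (x : NormalCoordinates M) {K : Ideal (MvPowerSeries (Fin n) ℂ)} :
    x.essentialIdeal ≤ K ↔ ∀ k, x.segreQ k ∈ K.map (rename (Sum.inr : _ → Fin n ⊕ Fin n)) := by
  simp only [mem_map_rename_inr_iff, coeff_sumAlgEquiv_segreQ, essentialIdeal, Ideal.span_le]
  constructor
  · exact fun h k a => h ⟨k, a, rfl⟩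
  · rintro h _ ⟨k, a, rfl⟩
    exact h k a

theorem killCompl_inl_segreQ (x : NormalCoordinates M) (k : Fin d) :
    killCompl Function.Embedding.inl (x.segreQ k) = 0 := by
  refine x.algHom_Q_eq_zero (φ := (killCompl _).comp (killCompl _)) ?_ k
  rintro (i | i)
  · have h : killCompl (R := ℂ) (Function.Embedding.sumMap (.refl (Fin n)) .inl)
        (X (Sum.inr (Sum.inl i : Fin n ⊕ Fin d))) = X (Sum.inr i) :=
      killCompl_X (e := Function.Embedding.sumMap (.refl _) .inl) (Sum.inr i)
    rw [AlgHom.comp_apply, h, killCompl_X_eq_zero (by simp)]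
  · rw [AlgHom.comp_apply, killCompl_X_eq_zero (by simp), map_zero]

theorem essentialIdeal_le_span_range_X (x : NormalCoordinates M) :
    x.essentialIdeal ≤ Ideal.span (Set.range X) := by
  rw [essentialIdeal_le_iff]
  intro k
  have h := sub_rename_killCompl_inl_mem (x.segreQ k)
  rw [killCompl_inl_segreQ, map_zero, sub_zero] at h
  rw [Ideal.map_span, ← Set.range_comp]
  simpa only [Function.comp_def, rename_X] using h

/-- The parametrization `(z, χ) ↦ (z, Q(z, χ, 0), χ, 0)` of the part of `M` with `τ = 0`. -/
noncomputable def leaf (x : NormalCoordinates M) :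
    FormalMap (Fin n ⊕ Fin n) ((Fin n ⊕ Fin d) ⊕ (Fin n ⊕ Fin d)) where
  toSeries := Sum.elim (Sum.elim (fun i => X (Sum.inl i)) x.segreQ)
    (Sum.elim (fun i => X (Sum.inr i)) fun _ => 0)
  constantCoeff_eq_zero := by
    rintro ((i | _) | (i | _))
    · simp
    · exact (constantCoeff_algHom (killCompl Function.Embedding.inl) _).symm.trans
        (by rw [Sum.elim_inl, Sum.elim_inr, killCompl_inl_segreQ, map_zero])
    · simp
    · simp

theorem leaf_pullback_toAmbient_Q (x : NormalCoordinates M) (k : Fin d) :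
    x.leaf.pullback (toAmbient (x.Q k)) = x.segreQ k := by
  have h : x.leaf.pullback.comp toAmbient =
      killCompl (Function.Embedding.sumMap (.refl _) .inl) := by
    refine algHom_ext_of_X ?_
    rintro (i | i | i) <;> simp only [toAmbient, AlgHom.comp_apply, rename_X, FormalMap.pullback_X]
    · exact (killCompl_X (e := Function.Embedding.sumMap (.refl _) .inl) (Sum.inl i)).symm
    · exact (killCompl_X (e := Function.Embedding.sumMap (.refl _) .inl) (Sum.inr i)).symm
    · exact (killCompl_X_eq_zero (by simp)).symm
  exact AlgHom.congr_fun h (x.Q k)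

theorem leaf_pullback_graph (x : NormalCoordinates M) (k : Fin d) :
    x.leaf.pullback (x.graph k) = 0 := by
  rw [graph, map_sub, leaf_pullback_toAmbient_Q, FormalMap.pullback_X]
  exact sub_self _

end SegreVarieties

section Transversality

theorem killCompl_inl_graph (x : NormalCoordinates M) (k : Fin d) :
    killCompl Function.Embedding.inl (x.graph k) = X (Sum.inr k) := by
  have hQ : killCompl Function.Embedding.inl (toAmbient (x.Q k)) = 0 := by
    refine x.algHom_Q_eq_zero (φ := (killCompl _).comp toAmbient) (fun i => ?_) k
    rw [AlgHom.comp_apply, toAmbient, rename_X]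
    exact killCompl_X_eq_zero (by simp)
  rw [graph, map_sub, hQ, sub_zero]
  exact killCompl_X (e := Function.Embedding.inl) _

theorem coord_differential_inv_differential (x : NormalCoordinates M) (v : Fin (n + d) → ℂ) :
    x.coord.differential (x.inv.differential v) = v := by
  rw [← LinearMap.comp_apply, ← FormalMap.differential_comp, x.coord_comp_inv,
    FormalMap.differential_id, LinearMap.id_apply]

theorem inv_differential_coord_differential (x : NormalCoordinates M) (v : Fin n ⊕ Fin d → ℂ) :
    x.inv.differential (x.coord.differential v) = v := by
  rw [← LinearMap.comp_apply, ← FormalMap.differential_comp, x.inv_comp_coord,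
    FormalMap.differential_id, LinearMap.id_apply]

theorem inv_differential_inr_eq_zero (x : NormalCoordinates M) {v : Fin (n + d) → ℂ}
    (hv : v ∈ M.holTangent) (k : Fin d) : x.inv.differential v (Sum.inr k) = 0 := by
  obtain ⟨a, ha, hrho⟩ := x.exists_doublePullback_rho_eq
  set u := x.inv.differential v
  -- at `ζ = 0` the defining equation reads `ρ(Z(z, w), 0) = a(z, w, 0) w`
  have hrho_zero (j : Fin d) :
      x.coord.pullback (killCompl Function.Embedding.inl (M.rho j)) =
        ∑ k, killCompl Function.Embedding.inl (a j k) * X (Sum.inr k) := by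
    rw [← killCompl_inl_sumMap _ x.coord.conj.pullback]
    exact (congrArg _ (hrho j)).trans (by simp only [map_sum, map_mul, killCompl_inl_graph])
  have hmul : (a.map constantCoeff).mulVec (fun k => u (Sum.inr k)) = 0 := by
    funext j
    calc (a.map constantCoeff).mulVec (fun k => u (Sum.inr k)) j
        = ∑ k, constantCoeff (killCompl Function.Embedding.inl (a j k)) * u (Sum.inr k) := by
          simp [Matrix.mulVec, dotProduct]
      _ = ∑ s, coeff (Finsupp.single (Sum.inl s) 1) (M.rho j) * x.coord.differential u s := by
          rw [← sum_coeff_single_mul_of_eq_sum (hrho_zero j)]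
          simp only [coeff_single_algHom, FormalMap.pullback_X, FormalMap.differential_apply,
            Finset.sum_mul, Finset.mul_sum, mul_assoc, coeff_killCompl,
            Finsupp.embDomain_single, Function.Embedding.inl_apply]
          exact Finset.sum_comm
      _ = 0 := by
          rw [coord_differential_inv_differential]
          exact congrFun hv j
  exact congrFun (Matrix.mulVec_injective_of_isUnit (isUnit_map_constantCoeff_iff.mpr ha)
    (hmul.trans (Matrix.mulVec_zero _).symm)) k

theorem express_inr_mem_span (x : NormalCoordinates M) (x' : NormalCoordinates M')
    {H : FormalMap (Fin (n + d)) (Fin (n + d))} (hH : H.MapsInto M M') (k : Fin d) :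
    (express x x' H).toSeries (Sum.inr k) ∈ Ideal.span (Set.range fun l => X (Sum.inr l)) := by
  have hle : Ideal.span (Set.range x.graph) ≤ (Ideal.span (Set.range fun l =>
      (X (Sum.inr l) : MvPowerSeries (Fin n ⊕ Fin d) ℂ))).comap
        (killCompl (R := ℂ) Function.Embedding.inl) := by
    rw [Ideal.span_le]
    rintro _ ⟨l, rfl⟩
    rw [SetLike.mem_coe, Ideal.mem_comap, killCompl_inl_graph]
    exact Ideal.subset_span ⟨l, rfl⟩
  have hmem := hle (doublePullback_express_graph_mem x x' hH k)
  rwa [Ideal.mem_comap, FormalMap.doublePullback, killCompl_inl_sumMap, killCompl_inl_graph,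
    FormalMap.pullback_X] at hmem

theorem isUnit_of_isCRTransversal (x : NormalCoordinates M) (x' : NormalCoordinates M')
    {H : FormalMap (Fin (n + d)) (Fin (n + d))} (hT : H.IsCRTransversal M')
    {b : Matrix (Fin d) (Fin d) (MvPowerSeries (Fin n ⊕ Fin d) ℂ)}
    (hb : ∀ k, (express x x' H).toSeries (Sum.inr k) = ∑ l, b k l * X (Sum.inr l)) :
    IsUnit b := by
  rw [← isUnit_map_constantCoeff_iff, ← Matrix.mulVec_surjective_iff_isUnit]
  intro y
  have hy : x'.coord.differential (Sum.elim 0 y) ∈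
      M'.holTangent ⊔ LinearMap.range H.differential := hT.symm ▸ Submodule.mem_top
  obtain ⟨t, ht, _, ⟨q, rfl⟩, hsum⟩ := Submodule.mem_sup.mp hy
  refine ⟨fun l => x.inv.differential q (Sum.inr l), funext fun k => ?_⟩
  calc (b.map constantCoeff).mulVec (fun l => x.inv.differential q (Sum.inr l)) k
      = (express x x' H).differential (x.inv.differential q) (Sum.inr k) :=
        (sum_coeff_single_mul_of_eq_sum (hb k) _).symm
    _ = x'.inv.differential (H.differential q) (Sum.inr k) := by
        rw [express, FormalMap.differential_comp, FormalMap.differential_comp,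
          LinearMap.comp_apply, LinearMap.comp_apply, coord_differential_inv_differential]
    _ = x'.inv.differential (t + H.differential q) (Sum.inr k) := by
        rw [map_add, Pi.add_apply, inv_differential_inr_eq_zero x' ht, zero_add]
    _ = y k := by rw [hsum, inv_differential_coord_differential, Sum.elim_inr]

theorem exists_isUnit_express_inr_eq (x : NormalCoordinates M) (x' : NormalCoordinates M')
    {H : FormalMap (Fin (n + d)) (Fin (n + d))} (hH : H.MapsInto M M')
    (hT : H.IsCRTransversal M') :
    ∃ b : Matrix (Fin d) (Fin d) (MvPowerSeries (Fin n ⊕ Fin d) ℂ), IsUnit b ∧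
      ∀ k, (express x x' H).toSeries (Sum.inr k) = ∑ l, b k l * X (Sum.inr l) := by
  choose b hb using fun k =>
    Ideal.mem_span_range_iff_exists_fun.mp (express_inr_mem_span x x' hH k)
  exact ⟨b, isUnit_of_isCRTransversal x x' hT fun k => (hb k).symm, fun k => (hb k).symm⟩

end Transversality

section SegreMap

variable (x : NormalCoordinates M) (x' : NormalCoordinates M')
  (H : FormalMap (Fin (n + d)) (Fin (n + d)))

theorem killCompl_inl_express (i : Fin n) :
    killCompl Function.Embedding.inl ((express x x' H).toSeries (Sum.inl i)) =
      segreSeries x x' H i := by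
  rw [segreSeries, algHom_apply_eq_subst]
  congr 1
  funext j
  rcases j with j | j
  · exact killCompl_X (e := Function.Embedding.inl) j
  · exact killCompl_X_eq_zero (by simp)

/-- The mapping `z ↦ F(z, 0)` between the Segre varieties of the origin. -/
noncomputable def segreMap : FormalMap (Fin n) (Fin n) where
  toSeries := segreSeries x x' H
  constantCoeff_eq_zero i := by
    rw [← killCompl_inl_express, constantCoeff_algHom, (express x x' H).constantCoeff_eq_zero]

theorem span_segreMap_pullback_X :
    Ideal.span (Set.range fun i => (segreMap x x' H).pullback (X i)) = segreIdeal x x' H := by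
  simp only [FormalMap.pullback_X]
  rfl

theorem span_segreMap_conj_pullback_X :
    Ideal.span (Set.range fun i => (segreMap x x' H).conj.pullback (X i)) =
      Ideal.span (Set.range fun i => conjSeries (segreSeries x x' H i)) := by
  simp only [FormalMap.pullback_X]
  rfl

/-- The pullback of series along `(z, χ) ↦ (F(z, Q(z, χ, 0)), F̄(χ, 0))`. -/
noncomputable def leafPullback :
    MvPowerSeries (Fin n ⊕ Fin n) ℂ →ₐ[ℂ] MvPowerSeries (Fin n ⊕ Fin n) ℂ :=
  ((x.leaf.pullback.comp (express x x' H).doublePullback).comp toAmbient).comp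
    (rename (Function.Embedding.sumMap (.refl _) .inl))

theorem leaf_pullback_rename_inr (f : MvPowerSeries (Fin n ⊕ Fin d) ℂ) :
    x.leaf.pullback (rename Sum.inr f) =
      rename Sum.inr (killCompl Function.Embedding.inl f) := by
  have h : x.leaf.pullback.comp (rename Sum.inr) =
      (rename Sum.inr).comp (killCompl Function.Embedding.inl) := by
    refine algHom_ext_of_X ?_
    rintro (i | i) <;> simp only [AlgHom.comp_apply, rename_X, FormalMap.pullback_X]
    · rw [killCompl_inl_X_inl, rename_X]
      rfl
    · rw [killCompl_inl_X_inr, map_zero]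
      rfl
  exact AlgHom.congr_fun h f

theorem leafPullback_X_inl (i : Fin n) :
    leafPullback x x' H (X (Sum.inl i)) =
      x.leaf.pullback (rename Sum.inl ((express x x' H).toSeries (Sum.inl i))) := by
  simp [leafPullback, toAmbient, rename_X, FormalMap.doublePullback]

theorem leafPullback_X_inr (i : Fin n) :
    leafPullback x x' H (X (Sum.inr i)) =
      rename Sum.inr ((segreMap x x' H).conj.pullback (X i)) := by
  have h : leafPullback x x' H (X (Sum.inr i)) =
      x.leaf.pullback (rename Sum.inr (conjSeries ((express x x' H).toSeries (Sum.inl i)))) := by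
    simp [leafPullback, toAmbient, rename_X, FormalMap.doublePullback, FormalMap.conj]
  rw [h, leaf_pullback_rename_inr, conjSeries, killCompl_map, killCompl_inl_express,
    FormalMap.pullback_X]
  rfl

theorem leafPullback_rename_inr (f : MvPowerSeries (Fin n) ℂ) :
    leafPullback x x' H (rename Sum.inr f) =
      rename Sum.inr ((segreMap x x' H).conj.pullback f) := by
  have h : (leafPullback x x' H).comp (rename Sum.inr) =
      (rename Sum.inr).comp (segreMap x x' H).conj.pullback :=
    algHom_ext_of_X fun i => by
      rw [AlgHom.comp_apply, rename_X, leafPullback_X_inr, AlgHom.comp_apply]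
  exact AlgHom.congr_fun h f

variable {H} (hH : H.MapsInto M M')
include hH

theorem killCompl_inl_express_inr (k : Fin d) :
    killCompl Function.Embedding.inl ((express x x' H).toSeries (Sum.inr k)) = 0 := by
  obtain ⟨b, hb⟩ := Ideal.mem_span_range_iff_exists_fun.mp (express_inr_mem_span x x' hH k)
  rw [← hb, map_sum]
  exact Finset.sum_eq_zero fun l _ => by
    rw [map_mul, killCompl_X_eq_zero (by simp), mul_zero]

theorem leafPullback_segreQ (k : Fin d) :
    leafPullback x x' H (x'.segreQ k) =
      x.leaf.pullback (rename Sum.inl ((express x x' H).toSeries (Sum.inr k))) := by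
  let φ := (x.leaf.pullback.comp (express x x' H).doublePullback).comp toAmbient
  have htau : ∀ j ∉ Set.range (Function.Embedding.sumMap (.refl (Fin n)) .inl),
      φ (X j) = 0 := by
    rintro (i | i | i) hi
    · exact absurd ⟨Sum.inl i, rfl⟩ hi
    · exact absurd ⟨Sum.inr i, rfl⟩ hi
    · have h : φ (X (Sum.inr (Sum.inr i))) = x.leaf.pullback
          (rename Sum.inr (conjSeries ((express x x' H).toSeries (Sum.inr i)))) := by
        simp [φ, toAmbient, rename_X, FormalMap.doublePullback, FormalMap.conj]
      rw [h, leaf_pullback_rename_inr, conjSeries, killCompl_map,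
        killCompl_inl_express_inr x x' hH, map_zero, map_zero]
  have hgraph : x.leaf.pullback ((express x x' H).doublePullback (x'.graph k)) = 0 := by
    have hle : Ideal.span (Set.range x.graph) ≤ RingHom.ker x.leaf.pullback := by
      rw [Ideal.span_le]
      rintro _ ⟨l, rfl⟩
      exact x.leaf_pullback_graph l
    exact hle (doublePullback_express_graph_mem x x' hH k)
  rw [graph, map_sub, map_sub, sub_eq_zero, FormalMap.doublePullback, sumMap_X_inl,
    FormalMap.pullback_X] at hgraph
  exact (algHom_rename_killCompl _ htau (x'.Q k)).trans hgraph.symm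

theorem span_leafPullback_segreQ (hT : H.IsCRTransversal M') :
    Ideal.span (Set.range fun k => leafPullback x x' H (x'.segreQ k)) =
      Ideal.span (Set.range x.segreQ) := by
  obtain ⟨b, hb, hG⟩ := exists_isUnit_express_inr_eq x x' hH hT
  let φ := x.leaf.pullback.comp (rename Sum.inl)
  have hX (l : Fin d) : φ (X (Sum.inr l)) = x.segreQ l := by
    rw [AlgHom.comp_apply, rename_X, FormalMap.pullback_X]
    rfl
  refine span_range_eq_of_isUnit (hb.map φ.toRingHom.mapMatrix) fun k => ?_
  rw [leafPullback_segreQ x x' hH, hG]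
  refine (map_sum φ _ _).trans (Finset.sum_congr rfl fun l _ => ?_)
  rw [map_mul, hX]
  rfl

end SegreMap

section EssentialIdeals

variable (x : NormalCoordinates M) (x' : NormalCoordinates M')
  {H : FormalMap (Fin (n + d)) (Fin (n + d))}

theorem leaf_pullback_rename_inl_sub_mem (f : MvPowerSeries (Fin n ⊕ Fin d) ℂ) :
    x.leaf.pullback (rename Sum.inl f) - rename Sum.inl (killCompl Function.Embedding.inl f) ∈
      x.essentialIdeal.map (rename (Sum.inr : _ → Fin n ⊕ Fin n)) := by
  let φ := x.leaf.pullback.comp (rename Sum.inl)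
  let φ₀ := (rename (R := ℂ) (Sum.inl : _ → Fin n ⊕ Fin n)).comp
    (killCompl (Function.Embedding.inl : Fin n ↪ Fin n ⊕ Fin d))
  refine algHom_sub_mem (φ := φ) (ψ := φ₀) ?_ f
  rintro (i | k)
  · have hφ : φ (X (Sum.inl i)) = X (Sum.inl i) := by
      rw [AlgHom.comp_apply, rename_X, FormalMap.pullback_X]
      rfl
    have hφ₀ : φ₀ (X (Sum.inl i)) = X (Sum.inl i) := by
      rw [AlgHom.comp_apply, killCompl_inl_X_inl, rename_X]
    rw [hφ, hφ₀, sub_self]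
    exact zero_mem _
  · have hφ : φ (X (Sum.inr k)) = x.segreQ k := by
      rw [AlgHom.comp_apply, rename_X, FormalMap.pullback_X]
      rfl
    have hφ₀ : φ₀ (X (Sum.inr k)) = 0 := by
      rw [AlgHom.comp_apply, killCompl_inl_X_inr, map_zero]
    rw [hφ, hφ₀, sub_zero]
    exact x.essentialIdeal_le_iff.mp le_rfl k

theorem leafPullback_sub_sumMap_mem (f : MvPowerSeries (Fin n ⊕ Fin n) ℂ) :
    leafPullback x x' H f -
        sumMap (segreMap x x' H).pullback (segreMap x x' H).conj.pullback f ∈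
      x.essentialIdeal.map (rename (Sum.inr : _ → Fin n ⊕ Fin n)) := by
  refine algHom_sub_mem ?_ f
  rintro (i | i)
  · rw [leafPullback_X_inl, sumMap_X_inl, FormalMap.pullback_X]
    have h := x.leaf_pullback_rename_inl_sub_mem ((express x x' H).toSeries (Sum.inl i))
    rwa [killCompl_inl_express] at h
  · rw [leafPullback_X_inr, sumMap_X_inr, sub_self]
    exact zero_mem _

variable (hH : H.MapsInto M M') (hT : H.IsCRTransversal M')
include hH hT

theorem essentialIdeal_le_map :
    x.essentialIdeal ≤ x'.essentialIdeal.map (segreMap x x' H).conj.pullback := by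
  rw [essentialIdeal_le_iff]
  have hle : Ideal.span (Set.range x.segreQ) ≤
      (x'.essentialIdeal.map (segreMap x x' H).conj.pullback).map
        (rename (Sum.inr : _ → Fin n ⊕ Fin n)) := by
    rw [← span_leafPullback_segreQ x x' hH hT, Ideal.span_le]
    rintro _ ⟨k, rfl⟩
    have hmap : (x'.essentialIdeal.map (rename (Sum.inr : _ → Fin n ⊕ Fin n))).map
        (leafPullback x x' H) = (x'.essentialIdeal.map (segreMap x x' H).conj.pullback).map
          (rename (Sum.inr : _ → Fin n ⊕ Fin n)) := by
      rw [Ideal.map_mapₐ, Ideal.map_mapₐ]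
      congr 1
      exact AlgHom.ext (leafPullback_rename_inr x x' H)
    exact hmap ▸ Ideal.mem_map_of_mem _ (x'.essentialIdeal_le_iff.mp le_rfl k)
  exact fun k => hle (Ideal.subset_span ⟨k, rfl⟩)

theorem map_le_essentialIdeal (hF : IsSegreFinite x x' H) :
    x'.essentialIdeal.map (segreMap x x' H).conj.pullback ≤ x.essentialIdeal := by
  rw [Ideal.map_le_iff_le_comap, essentialIdeal_le_iff]
  intro k
  rw [mem_map_rename_inr_iff]
  have hleaf : leafPullback x x' H (x'.segreQ k) ∈
      x.essentialIdeal.map (rename (Sum.inr : _ → Fin n ⊕ Fin n)) := by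
    have hle : Ideal.span (Set.range x.segreQ) ≤
        x.essentialIdeal.map (rename (Sum.inr : _ → Fin n ⊕ Fin n)) := by
      rw [Ideal.span_le]
      rintro _ ⟨l, rfl⟩
      exact x.essentialIdeal_le_iff.mp le_rfl l
    rw [← span_leafPullback_segreQ x x' hH hT] at hle
    exact hle (Ideal.subset_span ⟨k, rfl⟩)
  have hsum : sumMap (segreMap x x' H).pullback (segreMap x x' H).conj.pullback (x'.segreQ k) ∈
      x.essentialIdeal.map (rename (Sum.inr : _ → Fin n ⊕ Fin n)) :=
    (Submodule.sub_mem_iff_right _ hleaf).mp (leafPullback_sub_sumMap_mem x x' (x'.segreQ k))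
  have hdescent : sumMap (AlgHom.id ℂ _) (segreMap x x' H).conj.pullback (x'.segreQ k) ∈
      x.essentialIdeal.map (rename (Sum.inr : _ → Fin n ⊕ Fin n)) := by
    refine mem_map_rename_inr_of_sumMap_id_mem (φ := (segreMap x x' H).pullback) rfl
      (by rwa [span_segreMap_pullback_X]) ?_
    rwa [← AlgHom.comp_apply, sumMap_comp_sumMap]
  rw [mem_map_rename_inr_iff] at hdescent
  intro a
  have h := hdescent a
  rw [sumAlgEquiv_sumMap_id, coeff_map] at h
  exact h

theorem isSegreFinite_of_isEssentiallyFinite (hM : x.IsEssentiallyFinite) :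
    IsSegreFinite x x' H := by
  have hle : x.essentialIdeal ≤
      Ideal.span (Set.range fun i => conjSeries (segreSeries x x' H i)) := by
    rw [← span_segreMap_conj_pullback_X]
    refine (essentialIdeal_le_map x x' hH hT).trans ?_
    refine (Ideal.map_mono x'.essentialIdeal_le_span_range_X).trans_eq ?_
    rw [Ideal.map_span, ← Set.range_comp]
    rfl
  have : Module.Finite ℂ (MvPowerSeries (Fin n) ℂ ⧸ x.essentialIdeal) := hM
  exact finite_quotient_span_conjSeries_iff.mp <| Module.Finite.of_surjective
    (Ideal.Quotient.factorₐ ℂ hle).toLinearMap (Ideal.Quotient.factor_surjective hle)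

theorem essentialIdeal_eq_map (hF : IsSegreFinite x x' H) :
    x.essentialIdeal = x'.essentialIdeal.map (segreMap x x' H).conj.pullback :=
  (essentialIdeal_le_map x x' hH hT).antisymm (map_le_essentialIdeal x x' hH hT hF)

omit hH hT in
theorem finite_quotient_segreMap_conj (hF : IsSegreFinite x x' H) :
    Module.Finite ℂ (MvPowerSeries (Fin n) ℂ ⧸
      Ideal.span (Set.range fun i => (segreMap x x' H).conj.pullback (X i))) := by
  rw [span_segreMap_conj_pullback_X]
  exact finite_quotient_span_conjSeries_iff.mpr hF

theorem isEssentiallyFinite_iff (hF : IsSegreFinite x x' H) :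
    x.IsEssentiallyFinite ↔ x'.IsEssentiallyFinite := by
  rw [IsEssentiallyFinite, essentialIdeal_eq_map x x' hH hT hF]
  exact finite_quotient_map_algHom_iff rfl (finite_quotient_segreMap_conj x x' hF) _

theorem essentialType_eq_mul (hF : IsSegreFinite x x' H) :
    x.essentialType = segreMultiplicity x x' H * x'.essentialType := by
  rw [essentialType, essentialIdeal_eq_map x x' hH hT hF,
    finrank_quotient_map_algHom rfl (finite_quotient_segreMap_conj x x' hF),
    span_segreMap_conj_pullback_X, finrank_quotient_span_conjSeries]
  rfl

end EssentialIdeals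

end NormalCoordinates

theorem proposition6p3 {n d : ℕ} (M M' : FormalGenericSubmanifold (n + d) d)
    (H : FormalMap (Fin (n + d)) (Fin (n + d))) (hH : H.MapsInto M M')
    (hT : H.IsCRTransversal M')
    (x : NormalCoordinates M) (x' : NormalCoordinates M') :
    (x.IsEssentiallyFinite →
      x'.IsEssentiallyFinite ∧ NormalCoordinates.IsSegreFinite x x' H ∧
        x.essentialType = NormalCoordinates.segreMultiplicity x x' H * x'.essentialType) ∧
    (x'.IsEssentiallyFinite → NormalCoordinates.IsSegreFinite x x' H →
      x.IsEssentiallyFinite ∧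
        x.essentialType = NormalCoordinates.segreMultiplicity x x' H * x'.essentialType) := by
  refine ⟨fun hM => ?_, fun hM' hF => ?_⟩
  · have hF := NormalCoordinates.isSegreFinite_of_isEssentiallyFinite x x' hH hT hM
    exact ⟨(NormalCoordinates.isEssentiallyFinite_iff x x' hH hT hF).mp hM, hF,
      NormalCoordinates.essentialType_eq_mul x x' hH hT hF⟩
  · exact ⟨(NormalCoordinates.isEssentiallyFinite_iff x x' hH hT hF).mpr hM',
      NormalCoordinates.essentialType_eq_mul x x' hH hT hF⟩
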